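/- Let $\Omega$ be a set of three states, $r:\Omega\to\mathbb R$ the investor's payoff from investing, and $\delta\in[0,1)$ a discount factor. The state follows an irreducible Markov chain on $\Omega$ with transition matrix $M$ and invariant distribution $m$. Beliefs are elements of the simplex $\Delta(\Omega)\subset\mathbb R^\Omega$. Put $\phi(q)=qM$, $I=\{p\in\Delta(\Omega):\langle p,r\rangle\ge 0\}$ (the investment region), $\mathcal F=\{p\in\Delta(\Omega):\langle p,r\rangle=0\}$ and $\Omega^-=\{\omega: r(\omega)<0\}$. Suppose that $\phi$ is a homothety with center $m$ and nonnegative ratio: $\phi(p)-m=\lambda(p-m)$ for all $p\in\Delta(\Omega)$, for some $\lambda\in[0,1)$. Consider the following dynamic problem with initial belief $p_1\in\Delta(\Omega)$. In each round $n\ge 1$ the advisor chooses, as a measurable function of the past posterior beliefs $q_1,\dots,q_{n-1}$, a splitting at $p_n$, that is, a probability distribution on $\Delta(\Omega)$ with mean $p_n$; the posterior belief $q_n$ is drawn from it, and $p_{n+1}=\phi(q_n)$. The payoff of a strategy is $(1-\delta)\sum_{n\ge1}\delta^{n-1}\,\mathbf P(q_n\in I)$. A greedy strategy is a stationary strategy,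 measurable in the current belief $p$, that discloses nothing (chooses the Dirac mass at $p$) when $p\in I$, and that chooses, when $p\notin I$, the two-point splitting given by a solution of: maximize $a_I$ subject to $p=a_Iq_I+a_Jq_J$, $q_I\in I$, $q_J\in\Delta(\Omega)$, $a_I+a_J=1$, $a_I,a_J\ge 0$. Assume that one of the following holds: (i) $|\Omega^-|=1$; or (ii) $|\Omega^-|=2$ and either $m\in I$, or $m$ belongs to the triangle with vertices $C^+,B^+,C$, where $\Omega=\{A,B,C\}$, $\Omega^-=\{B,C\}$ with $r(B)\ge r(C)$, and $B^+$ and $C^+$ are the points of $\mathcal F$ on the edges $[A,B]$ and $[A,C]$. Then greedy strategies exist, and every greedy strategy is optimal: for every initial belief $p_1\in\Delta(\Omega)$, no strategy has a higher payoff. -/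

import Mathlib

open MeasureTheory ProbabilityTheory

namespace Persuasion

/-- Beliefs over the finite state space `Ω`: the unit simplex `Δ(Ω)` in `ℝ^Ω`
(with the Borel structure inherited from `Ω → ℝ`). -/
abbrev Belief (Ω : Type*) [Fintype Ω] : Type _ := ↥(stdSimplex ℝ Ω)

/-- The degenerate belief concentrated on the state `ω`, as a unit basis vector of `ℝ^Ω`. -/
abbrev vertex {Ω : Type*} [DecidableEq Ω] (ω : Ω) : Ω → ℝ := Pi.single ω 1

/-- The expected net payoff `⟨p, r⟩` from investing at the belief `p`. -/
def expPayoff {Ω : Type*} [Fintype Ω] (r : Ω → ℝ) (p : Belief Ω) : ℝ :=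
  ∑ ω, p.1 ω * r ω

/-- The investment region `I`. -/
def investRegion {Ω : Type*} [Fintype Ω] (r : Ω → ℝ) : Set (Belief Ω) :=
  {p | 0 ≤ expPayoff r p}

/-- The investment frontier `𝓕`. -/
def investFrontier {Ω : Type*} [Fintype Ω] (r : Ω → ℝ) : Set (Belief Ω) :=
  {p | expPayoff r p = 0}

/-- The set `Ω⁻` of states with negative payoff. -/
noncomputable def negStates {Ω : Type*} [Fintype Ω] (r : Ω → ℝ) : Finset Ω :=
  Finset.univ.filter fun ω => r ω < 0

/-- The drift map `φ(q) = q M` on beliefs, for a transition matrix `M`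
(`M ω ω'` is the probability to move from `ω` to `ω'`). -/
def drift {Ω : Type*} [Fintype Ω] [DecidableEq Ω] (M : Matrix Ω Ω ℝ)
    (hM : M ∈ Matrix.rowStochastic ℝ Ω) (q : Belief Ω) : Belief Ω :=
  ⟨Matrix.vecMul q.1 M, by
    obtain ⟨hM0, hM1⟩ := Matrix.mem_rowStochastic_iff_sum.1 hM
    refine ⟨fun j => Finset.sum_nonneg fun i _ => mul_nonneg (q.2.1 i) (hM0 i j), ?_⟩
    simp only [Matrix.vecMul, dotProduct]
    rw [Finset.sum_comm]
    simp only [← Finset.mul_sum, hM1, mul_one]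
    exact q.2.2⟩

/-- `φ` is a homothety of the simplex with center `m` and some ratio `lam ∈ [0, 1)`. -/
def IsHomothety {Ω : Type*} [Fintype Ω] (φ : Belief Ω → Belief Ω) (m : Belief Ω) : Prop :=
  ∃ lam : ℝ, 0 ≤ lam ∧ lam < 1 ∧ ∀ p : Belief Ω, (φ p).1 - m.1 = lam • (p.1 - m.1)

/-- `μ ∈ 𝓢(p)`: `μ` is a probability distribution over beliefs with mean `p`. -/
def IsSplitting {Ω : Type*} [Fintype Ω] (p : Belief Ω) (μ : Measure (Belief Ω)) : Prop :=
  IsProbabilityMeasure μ ∧ ∀ ω, ∫ q : Belief Ω, q.1 ω ∂μ = p.1 ω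

/-- The prior belief `p_{n+1}` held in round `n + 1` before the message of that round, when the
posterior beliefs of the first `n` rounds are `h 0, …, h (n - 1)`. -/
def prior {Ω : Type*} [Fintype Ω] (φ : Belief Ω → Belief Ω) (p₁ : Belief Ω) :
    (n : ℕ) → (Fin n → Belief Ω) → Belief Ω
  | 0, _ => p₁
  | n + 1, h => φ (h (Fin.last n))

/-- A (history-dependent) strategy of the advisor in the dynamic problem with initial belief `p₁`
and drift `φ`: in each round it chooses, measurably in the past posterior beliefs, a splitting at
the current prior belief. -/
structure Strategy {Ω : Type*} [Fintype Ω] (φ : Belief Ω → Belief Ω) (p₁ : Belief Ω) where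
  kernel : (n : ℕ) → Kernel (Fin n → Belief Ω) (Belief Ω)
  splitting : ∀ n h, IsSplitting (prior φ p₁ n h) (kernel n h)

/-- The law of the posterior beliefs of the first `n` rounds under a strategy. -/
noncomputable def Strategy.law {Ω : Type*} [Fintype Ω] {φ : Belief Ω → Belief Ω}
    {p₁ : Belief Ω} (σ : Strategy φ p₁) : (n : ℕ) → Measure (Fin n → Belief Ω)
  | 0 => Measure.dirac Fin.elim0
  | n + 1 => (σ.law n ⊗ₘ σ.kernel n).map
      fun x => Fin.snoc (α := fun _ => Belief Ω) x.1 x.2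

/-- The expected discounted frequency of rounds in which investment takes place
(`n` counts rounds from `0`, so the weight of round `n` is `(1 - δ) δ ^ n`). -/
noncomputable def Strategy.payoff {Ω : Type*} [Fintype Ω] {φ : Belief Ω → Belief Ω}
    {p₁ : Belief Ω} (r : Ω → ℝ) (δ : ℝ) (σ : Strategy φ p₁) : ℝ :=
  ∑' n : ℕ, (1 - δ) * δ ^ n * (σ.law (n + 1)).real {h | h (Fin.last n) ∈ investRegion r}

/-- `σ` is optimal at the initial belief `p₁`: no strategy has a higher payoff. -/
def Strategy.IsOptimal {Ω : Type*} [Fintype Ω] {φ : Belief Ω → Belief Ω}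
    {p₁ : Belief Ω} (r : Ω → ℝ) (δ : ℝ) (σ : Strategy φ p₁) : Prop :=
  ∀ τ : Strategy φ p₁, τ.payoff r δ ≤ σ.payoff r δ

/-- A stationary strategy: the splitting depends only on the current belief. -/
structure StationaryStrategy (Ω : Type*) [Fintype Ω] where
  kernel : Kernel (Belief Ω) (Belief Ω)
  splitting : ∀ p, IsSplitting p (kernel p)

theorem measurable_drift {Ω : Type*} [Fintype Ω] [DecidableEq Ω] (M : Matrix Ω Ω ℝ)
    (hM : M ∈ Matrix.rowStochastic ℝ Ω) : Measurable (drift M hM) := by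
  refine Measurable.subtype_mk (measurable_pi_lambda _ fun j => ?_)
  simp only [Matrix.vecMul, dotProduct]
  exact Finset.measurable_sum _ fun i _ =>
    ((measurable_pi_apply i).comp measurable_subtype_coe).mul_const _

theorem measurable_prior {Ω : Type*} [Fintype Ω] {φ : Belief Ω → Belief Ω}
    (hφ : Measurable φ) (p₁ : Belief Ω) : ∀ n, Measurable (prior φ p₁ n)
  | 0 => measurable_const
  | n + 1 => hφ.comp (measurable_pi_apply (Fin.last n))

/-- The strategy, from the initial belief `p₁`, that plays a stationary strategy forever. -/
def StationaryStrategy.toStrategy {Ω : Type*} [Fintype Ω] (s : StationaryStrategy Ω)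
    {φ : Belief Ω → Belief Ω} (hφ : Measurable φ) (p₁ : Belief Ω) : Strategy φ p₁ where
  kernel n := s.kernel.comap (prior φ p₁ n) (measurable_prior hφ p₁ n)
  splitting n h := by
    rw [Kernel.comap_apply]
    exact s.splitting _

/-- `p = aI qI + aJ qJ` is feasible: `qI ∈ I`, `aI + aJ = 1`, `aI, aJ ≥ 0`. -/
def IsFeasible {Ω : Type*} [Fintype Ω] (r : Ω → ℝ) (p : Belief Ω)
    (aI aJ : ℝ) (qI qJ : Belief Ω) : Prop :=
  p.1 = aI • qI.1 + aJ • qJ.1 ∧ qI ∈ investRegion r ∧ aI + aJ = 1 ∧ 0 ≤ aI ∧ 0 ≤ aJ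

/-- `p = aI qI + aJ qJ` is a greedy splitting at `p`: it is feasible, and `aI` is maximal. -/
def IsGreedySplitting {Ω : Type*} [Fintype Ω] (r : Ω → ℝ) (p : Belief Ω)
    (aI aJ : ℝ) (qI qJ : Belief Ω) : Prop :=
  IsFeasible r p aI aJ qI qJ ∧
    ∀ (bI bJ : ℝ) (uI uJ : Belief Ω), IsFeasible r p bI bJ uI uJ → bI ≤ aI

/-- A greedy strategy: it discloses nothing at `p ∈ I`, and it chooses a greedy splitting
at each `p ∉ I`. -/
def StationaryStrategy.IsGreedy {Ω : Type*} [Fintype Ω] (r : Ω → ℝ)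
    (s : StationaryStrategy Ω) : Prop :=
  (∀ p ∈ investRegion r, s.kernel p = Measure.dirac p) ∧
  ∀ p ∉ investRegion r, ∃ (aI aJ : ℝ) (qI qJ : Belief Ω), IsGreedySplitting r p aI aJ qI qJ ∧
    s.kernel p = ENNReal.ofReal aI • Measure.dirac qI + ENNReal.ofReal aJ • Measure.dirac qJ

/-- With `Ω = {A, B, C}`, `Ω⁻ = {B, C}` and `r B ≥ r C`, the belief `m` lies in the triangle with
vertices `C⁺`, `B⁺`, `C`, where `B⁺` and `C⁺` are the points at which the investment frontier meets
the edges `[A, B]` and `[A, C]`. -/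
def InTriangle {Ω : Type*} [Fintype Ω] [DecidableEq Ω] (r : Ω → ℝ) (m : Belief Ω) : Prop :=
  ∃ (A B C : Ω) (Bplus Cplus : Belief Ω),
    0 ≤ r A ∧ negStates r = {B, C} ∧ B ≠ C ∧ r C ≤ r B ∧
    Bplus ∈ investFrontier r ∧ Bplus.1 ∈ segment ℝ (vertex A) (vertex B) ∧
    Cplus ∈ investFrontier r ∧ Cplus.1 ∈ segment ℝ (vertex A) (vertex C) ∧
    m.1 ∈ convexHull ℝ {Cplus.1, Bplus.1, vertex C}

end Persuasion

open Persuasion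

/-!
Why greedy strategies are optimal. Beliefs are extended to vectors with nonnegative entries, on
which the drift is linear, `x ↦ lam • x + (1 - lam) |x| m`, and a splitting is a decomposition
into a sum. A candidate value function is a lower envelope of linear functionals; it is then
concave, so that Jensen's inequality holds for all splittings. By
`StationaryStrategy.isOptimal_of_envelope`, a stationary strategy is optimal if such an envelope
`W` satisfies `(1 - δ) 1_I + δ W ∘ φ ≤ W` and the strategy attains `W` at each belief.

If only the expected payoff `y` of a belief matters, the envelope is explicit
(`IsReducedFamily`): it is linear on `y ≤ 0`, and on `y ≥ 0` it is the value of investing for as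
long as possible. Exchange arguments show that a greedy splitting at `p ∉ I` invests all the mass
of nonnegative states at zero total payoff. If all negative payoffs are equal, the remaining part
has the least possible payoff, so that greedy strategies attain this envelope
(`IsReducedFamily.isOptimal`).

Otherwise there are negative states `B` and `C` with `r C < r B`, a greedy splitting uses mass of
`B` before mass of `C`, and the hypotheses on `m` say that `m` lies on the side of `A` of the line
through `C` and the frontier point `B⁺` of the edge `[A, B]`. On this side, which the drift
preserves, the value is that of the reduced problem. On the other side, the value of `f + q`, with
`f` proportional to `B⁺` and `q` on the edge `[B, C]`, is `v |f| + δ W (φ q)`; the functionals that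
produce it are obtained by iterating `waitFunctional`, and are collected in `waitFamily`. The point
that is not formal is that waiting with `f + q` is no better (`wait_le_const_add`): it follows from
concavity of `W` on the ray from `lam • q` in the direction of `m`, together with
`δ W (φ q) ≤ W q`.
-/

namespace Persuasion

/-! ### Payoffs of strategies and verification -/

section Verification

variable {Ω : Type*} [Fintype Ω]

theorem measurable_expPayoff (r : Ω → ℝ) : Measurable (expPayoff r) := by
  unfold expPayoff
  exact Finset.measurable_sum _ fun ω _ =>
    ((measurable_pi_apply ω).comp measurable_subtype_coe).mul_const _

theorem measurableSet_investRegion (r : Ω → ℝ) : MeasurableSet (investRegion r) :=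
  measurableSet_le measurable_const (measurable_expPayoff r)

theorem integrable_of_bounded {α : Type*} [MeasurableSpace α] {μ : Measure α} [IsFiniteMeasure μ]
    {F : α → ℝ} (hF : Measurable F) {K : ℝ} (hK : ∀ a, |F a| ≤ K) : Integrable F μ :=
  Integrable.of_bound hF.aestronglyMeasurable K (Filter.Eventually.of_forall hK)

variable {φ : Belief Ω → Belief Ω} {p₁ : Belief Ω}

instance (σ : Strategy φ p₁) (n : ℕ) : IsMarkovKernel (σ.kernel n) :=
  ⟨fun h => (σ.splitting n h).1⟩

instance (s : StationaryStrategy Ω) : IsMarkovKernel s.kernel :=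
  ⟨fun p => (s.splitting p).1⟩

theorem measurable_snoc (n : ℕ) : Measurable fun x : (Fin n → Belief Ω) × Belief Ω =>
    Fin.snoc (α := fun _ => Belief Ω) x.1 x.2 := by
  refine measurable_pi_lambda _ fun i => ?_
  refine Fin.lastCases ?_ (fun j => ?_) i
  · simpa using measurable_snd
  · simpa [Function.comp_def] using
      (measurable_pi_apply (X := fun _ : Fin n => Belief Ω) j).comp measurable_fst

instance (σ : Strategy φ p₁) (n : ℕ) : IsProbabilityMeasure (σ.law n) := by
  induction n with
  | zero => exact Measure.dirac.isProbabilityMeasure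
  | succ n ih => exact Measure.isProbabilityMeasure_map (measurable_snoc n).aemeasurable

/-- The law of the last posterior: first draw the history, then apply the kernel. -/
theorem Strategy.integral_law_succ (σ : Strategy φ p₁) (n : ℕ) {F : Belief Ω → ℝ}
    (hF : Measurable F) {K : ℝ} (hK : ∀ q, |F q| ≤ K) :
    ∫ h, F (h (Fin.last n)) ∂σ.law (n + 1) = ∫ h, ∫ q, F q ∂σ.kernel n h ∂σ.law n := by
  have hm : Measurable fun h : Fin (n + 1) → Belief Ω => F (h (Fin.last n)) :=
    hF.comp (measurable_pi_apply _)
  rw [Strategy.law, integral_map (measurable_snoc n).aemeasurable hm.aestronglyMeasurable]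
  simp only [Fin.snoc_last]
  exact Measure.integral_compProd
    (integrable_of_bounded (hF.comp measurable_snd) fun a => hK a.2)

/-- One round of payoff plus the discounted continuation value, when the posterior is `q`. -/
noncomputable def reward (r : Ω → ℝ) (δ : ℝ) (φ : Belief Ω → Belief Ω) (W : Belief Ω → ℝ)
    (q : Belief Ω) : ℝ :=
  (1 - δ) * (investRegion r).indicator 1 q + δ * W (φ q)

variable {r : Ω → ℝ} {δ K : ℝ} {W : Belief Ω → ℝ}

theorem measurable_reward (hφ : Measurable φ) (hW : Measurable W) :
    Measurable (reward r δ φ W) :=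
  ((measurable_one.indicator (measurableSet_investRegion r)).const_mul _).add
    ((hW.comp hφ).const_mul _)

theorem abs_reward_le (hδ0 : 0 ≤ δ) (hδ1 : δ < 1) (hW0 : ∀ p, 0 ≤ W p) (hWK : ∀ p, W p ≤ K)
    (q : Belief Ω) : |reward r δ φ W q| ≤ 1 + K := by
  have h1 : 0 ≤ (investRegion r).indicator (1 : Belief Ω → ℝ) q :=
    Set.indicator_nonneg (fun _ _ => zero_le_one) q
  have h2 : (investRegion r).indicator (1 : Belief Ω → ℝ) q ≤ 1 :=
    Set.indicator_le_self' (fun _ _ => zero_le_one) q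
  have h3 := hW0 (φ q)
  have h4 := hWK (φ q)
  unfold reward
  rw [abs_of_nonneg (by nlinarith [mul_nonneg hδ0 h3, mul_nonneg (sub_nonneg.2 hδ1.le) h1])]
  nlinarith [mul_nonneg (sub_nonneg.2 hδ1.le) (sub_nonneg.2 h2), mul_nonneg hδ0 (sub_nonneg.2 h4)]

/-- The expectation of `W` at the prior held in round `n` (rounds counted from `0`). -/
noncomputable def Strategy.expValue (σ : Strategy φ p₁) (W : Belief Ω → ℝ) (n : ℕ) : ℝ :=
  ∫ h, W (prior φ p₁ n h) ∂σ.law n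

theorem Strategy.expValue_zero (σ : Strategy φ p₁) (W : Belief Ω → ℝ) :
    σ.expValue W 0 = W p₁ := by
  simp [Strategy.expValue, prior]

theorem Strategy.integral_reward (σ : Strategy φ p₁) (hδ0 : 0 ≤ δ) (hδ1 : δ < 1)
    (hφ : Measurable φ) (hW : Measurable W) (hW0 : ∀ p, 0 ≤ W p) (hWK : ∀ p, W p ≤ K) (n : ℕ) :
    ∫ h, ∫ q, reward r δ φ W q ∂σ.kernel n h ∂σ.law n =
      (1 - δ) * (σ.law (n + 1)).real {h | h (Fin.last n) ∈ investRegion r} +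
        δ * σ.expValue W (n + 1) := by
  rw [← σ.integral_law_succ n (measurable_reward hφ hW) (abs_reward_le hδ0 hδ1 hW0 hWK)]
  have hs : MeasurableSet {h : Fin (n + 1) → Belief Ω | h (Fin.last n) ∈ investRegion r} :=
    measurable_pi_apply (Fin.last n) (measurableSet_investRegion r)
  have hind : (fun h : Fin (n + 1) → Belief Ω =>
      (investRegion r).indicator (1 : Belief Ω → ℝ) (h (Fin.last n))) =
      {h : Fin (n + 1) → Belief Ω | h (Fin.last n) ∈ investRegion r}.indicator 1 := rfl
  simp only [reward]
  rw [integral_add, integral_const_mul, integral_const_mul, hind, integral_indicator_one hs]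
  · rfl
  · exact ((integrable_const (1 : ℝ)).indicator hs).const_mul _
  · refine (integrable_of_bounded (K := K) ?_ fun h => ?_).const_mul δ
    · exact hW.comp (hφ.comp (measurable_pi_apply _))
    · rw [abs_of_nonneg (hW0 _)]
      exact hWK _

theorem Strategy.expValue_nonneg (σ : Strategy φ p₁) (hW0 : ∀ p, 0 ≤ W p) (n : ℕ) :
    0 ≤ σ.expValue W n :=
  integral_nonneg fun _ => hW0 _

theorem Strategy.integrable_expValue (σ : Strategy φ p₁) (hφ : Measurable φ) (hW : Measurable W)
    (hW0 : ∀ p, 0 ≤ W p) (hWK : ∀ p, W p ≤ K) (n : ℕ) :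
    Integrable (fun h => W (prior φ p₁ n h)) (σ.law n) := by
  refine integrable_of_bounded (hW.comp (measurable_prior hφ p₁ n)) (K := K) fun h => ?_
  rw [abs_of_nonneg (hW0 _)]
  exact hWK _

theorem Strategy.expValue_le (σ : Strategy φ p₁) (hφ : Measurable φ) (hW : Measurable W)
    (hW0 : ∀ p, 0 ≤ W p) (hWK : ∀ p, W p ≤ K) (n : ℕ) : σ.expValue W n ≤ K := by
  calc σ.expValue W n ≤ ∫ _, K ∂σ.law n :=
        integral_mono (σ.integrable_expValue hφ hW hW0 hWK n) (integrable_const _) fun _ => hWK _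
    _ = K := by simp

theorem Strategy.integrable_integral_reward (σ : Strategy φ p₁) (hδ0 : 0 ≤ δ) (hδ1 : δ < 1)
    (hφ : Measurable φ) (hW : Measurable W) (hW0 : ∀ p, 0 ≤ W p) (hWK : ∀ p, W p ≤ K) (n : ℕ) :
    Integrable (fun h => ∫ q, reward r δ φ W q ∂σ.kernel n h) (σ.law n) := by
  have h1 : Integrable (fun x : (Fin n → Belief Ω) × Belief Ω => reward r δ φ W x.2)
      (σ.law n ⊗ₘ σ.kernel n) :=
    integrable_of_bounded ((measurable_reward hφ hW).comp measurable_snd)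
      fun x => abs_reward_le hδ0 hδ1 hW0 hWK x.2
  exact h1.integral_compProd

theorem Strategy.summable_payoff (σ : Strategy φ p₁) (r : Ω → ℝ) (hδ0 : 0 ≤ δ) (hδ1 : δ < 1) :
    Summable fun n : ℕ =>
      (1 - δ) * δ ^ n * (σ.law (n + 1)).real {h | h (Fin.last n) ∈ investRegion r} := by
  refine Summable.of_nonneg_of_le (fun n => ?_) (fun n => ?_)
    ((summable_geometric_of_lt_one hδ0 hδ1).mul_left (1 - δ))
  · exact mul_nonneg (mul_nonneg (sub_nonneg.2 hδ1.le) (pow_nonneg hδ0 n)) measureReal_nonneg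
  · exact mul_le_of_le_one_right (mul_nonneg (sub_nonneg.2 hδ1.le) (pow_nonneg hδ0 n))
      measureReal_le_one

/-- If the function `W` dominates, at every prior, the expected reward of the next round, then it
bounds the payoff. -/
theorem Strategy.payoff_le (σ : Strategy φ p₁) (hδ0 : 0 ≤ δ) (hδ1 : δ < 1)
    (hφ : Measurable φ) (hW : Measurable W) (hW0 : ∀ p, 0 ≤ W p) (hWK : ∀ p, W p ≤ K)
    (hstep : ∀ n h, ∫ q, reward r δ φ W q ∂σ.kernel n h ≤ W (prior φ p₁ n h)) :
    σ.payoff r δ ≤ W p₁ := by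
  have hone : ∀ n, (1 - δ) * (σ.law (n + 1)).real {h | h (Fin.last n) ∈ investRegion r} +
      δ * σ.expValue W (n + 1) ≤ σ.expValue W n := fun n => by
    rw [← σ.integral_reward hδ0 hδ1 hφ hW hW0 hWK n]
    exact integral_mono (σ.integrable_integral_reward hδ0 hδ1 hφ hW hW0 hWK n)
      (σ.integrable_expValue hφ hW hW0 hWK n) fun h => hstep n h
  have hsum : ∀ N, ∑ n ∈ Finset.range N,
      (1 - δ) * δ ^ n * (σ.law (n + 1)).real {h | h (Fin.last n) ∈ investRegion r} +
        δ ^ N * σ.expValue W N ≤ W p₁ := fun N => by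
    induction N with
    | zero => simp [σ.expValue_zero]
    | succ N ih =>
      rw [Finset.sum_range_succ, pow_succ]
      nlinarith [mul_le_mul_of_nonneg_left (hone N) (pow_nonneg hδ0 N)]
  refine Real.tsum_le_of_sum_range_le (fun n => ?_) fun N => ?_
  · exact mul_nonneg (mul_nonneg (sub_nonneg.2 hδ1.le) (pow_nonneg hδ0 n)) measureReal_nonneg
  · have := hsum N
    have := mul_nonneg (pow_nonneg hδ0 N) (σ.expValue_nonneg hW0 N)
    linarith

/-- If the expected reward of the next round is at least `W` at every prior, then the payoff is
at least `W`. -/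
theorem Strategy.le_payoff (σ : Strategy φ p₁) (hδ0 : 0 ≤ δ) (hδ1 : δ < 1)
    (hφ : Measurable φ) (hW : Measurable W) (hW0 : ∀ p, 0 ≤ W p) (hWK : ∀ p, W p ≤ K)
    (hstep : ∀ n h, W (prior φ p₁ n h) ≤ ∫ q, reward r δ φ W q ∂σ.kernel n h) :
    W p₁ ≤ σ.payoff r δ := by
  have hone : ∀ n, σ.expValue W n ≤
      (1 - δ) * (σ.law (n + 1)).real {h | h (Fin.last n) ∈ investRegion r} +
      δ * σ.expValue W (n + 1) := fun n => by
    rw [← σ.integral_reward hδ0 hδ1 hφ hW hW0 hWK n]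
    exact integral_mono (σ.integrable_expValue hφ hW hW0 hWK n)
      (σ.integrable_integral_reward hδ0 hδ1 hφ hW hW0 hWK n) fun h => hstep n h
  have hsum : ∀ N, W p₁ ≤ ∑ n ∈ Finset.range N,
      (1 - δ) * δ ^ n * (σ.law (n + 1)).real {h | h (Fin.last n) ∈ investRegion r} +
        δ ^ N * σ.expValue W N := fun N => by
    induction N with
    | zero => simp [σ.expValue_zero]
    | succ N ih =>
      rw [Finset.sum_range_succ, pow_succ]
      nlinarith [mul_le_mul_of_nonneg_left (hone N) (pow_nonneg hδ0 N)]
  have hlim : Filter.Tendsto (fun N => σ.payoff r δ + δ ^ N * K) Filter.atTop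
      (nhds (σ.payoff r δ + 0 * K)) :=
    tendsto_const_nhds.add ((tendsto_pow_atTop_nhds_zero_of_lt_one hδ0 hδ1).mul_const K)
  rw [zero_mul, add_zero] at hlim
  refine ge_of_tendsto' hlim fun N => (hsum N).trans (add_le_add ?_ ?_)
  · exact (σ.summable_payoff r hδ0 hδ1).sum_le_tsum _ fun n _ =>
      mul_nonneg (mul_nonneg (sub_nonneg.2 hδ1.le) (pow_nonneg hδ0 n)) measureReal_nonneg
  · exact mul_le_mul_of_nonneg_left (σ.expValue_le hφ hW hW0 hWK N) (pow_nonneg hδ0 N)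

end Verification

/-! ### Lower envelopes of linear functionals and the optimality criterion -/

section Envelope

variable {Ω : Type*} [Fintype Ω]

/-- The lower envelope of a family of linear functionals on `ℝ^Ω`, each encoded by the vector of
its values at the unit basis vectors. It is evaluated at vectors with nonnegative entries, so that
it is the positively homogeneous extension of a concave function of beliefs. -/
noncomputable def envelope (L : Set (Ω → ℝ)) (x : Ω → ℝ) : ℝ := ⨅ ℓ : L, x ⬝ᵥ ℓ.1

variable {L : Set (Ω → ℝ)} {x ℓ : Ω → ℝ}

theorem envelope_le (hL : ∀ ℓ ∈ L, 0 ≤ ℓ) (hx : 0 ≤ x) (hℓ : ℓ ∈ L) :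
    envelope L x ≤ x ⬝ᵥ ℓ :=
  ciInf_le (f := fun ℓ : L => x ⬝ᵥ ℓ.1)
    ⟨0, by rintro _ ⟨k, rfl⟩; exact dotProduct_nonneg_of_nonneg hx (hL k.1 k.2)⟩ ⟨ℓ, hℓ⟩

theorem le_envelope (hne : L.Nonempty) {c : ℝ} (h : ∀ ℓ ∈ L, c ≤ x ⬝ᵥ ℓ) : c ≤ envelope L x :=
  have := hne.to_subtype
  le_ciInf fun ℓ : L => h ℓ.1 ℓ.2

theorem envelope_nonneg (hL : ∀ ℓ ∈ L, 0 ≤ ℓ) (hx : 0 ≤ x) : 0 ≤ envelope L x :=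
  Real.iInf_nonneg fun ℓ => dotProduct_nonneg_of_nonneg hx (hL ℓ.1 ℓ.2)

theorem envelope_smul (L : Set (Ω → ℝ)) (x : Ω → ℝ) {a : ℝ} (ha : 0 ≤ a) :
    envelope L (a • x) = a * envelope L x := by
  simp only [envelope, smul_dotProduct, smul_eq_mul]
  exact (Real.mul_iInf_of_nonneg ha _).symm

theorem measurable_envelope (hL : ∀ ℓ ∈ L, 0 ≤ ℓ) :
    Measurable fun p : Belief Ω => envelope L p.1 := by
  refine UpperSemicontinuous.measurable ?_
  refine upperSemicontinuous_ciInf (f := fun (ℓ : L) (p : Belief Ω) => p.1 ⬝ᵥ ℓ.1)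
    (fun p => ⟨0, ?_⟩) fun ℓ => Continuous.upperSemicontinuous ?_
  · rintro _ ⟨k, rfl⟩
    exact dotProduct_nonneg_of_nonneg p.2.1 (hL k.1 k.2)
  · exact Continuous.dotProduct continuous_subtype_val continuous_const

theorem integrable_dotProduct (μ : Measure (Belief Ω)) [IsFiniteMeasure μ] (ℓ : Ω → ℝ) :
    Integrable (fun q : Belief Ω => q.1 ⬝ᵥ ℓ) μ :=
  (Continuous.dotProduct continuous_subtype_val continuous_const).integrable_of_hasCompactSupport
    (HasCompactSupport.of_compactSpace _)

theorem integral_dotProduct_of_isSplitting {p : Belief Ω} {μ : Measure (Belief Ω)}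
    (h : IsSplitting p μ) (ℓ : Ω → ℝ) : ∫ q : Belief Ω, q.1 ⬝ᵥ ℓ ∂μ = p.1 ⬝ᵥ ℓ := by
  have := h.1
  simp only [dotProduct]
  rw [integral_finsetSum]
  · simp only [integral_mul_const, h.2]
  · intro ω _
    refine Integrable.mul_const ?_ _
    exact ((continuous_apply ω).comp
      continuous_subtype_val).integrable_of_hasCompactSupport (HasCompactSupport.of_compactSpace _)

/-- Jensen's inequality for a lower envelope, in the form used for splittings. -/
theorem integral_le_envelope (hne : L.Nonempty) {p : Belief Ω} {μ : Measure (Belief Ω)}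
    (h : IsSplitting p μ) {G : Belief Ω → ℝ} (hG : Integrable G μ)
    (hGL : ∀ q : Belief Ω, ∀ ℓ ∈ L, G q ≤ q.1 ⬝ᵥ ℓ) : ∫ q, G q ∂μ ≤ envelope L p.1 := by
  have := h.1
  refine le_envelope hne fun ℓ hℓ => ?_
  rw [← integral_dotProduct_of_isSplitting h ℓ]
  exact integral_mono hG (integrable_dotProduct μ ℓ) fun q => hGL q ℓ hℓ

/-- Optimality criterion: a stationary strategy is optimal as soon as some lower envelope of
nonnegative linear functionals dominates the one-round reward computed from itself, while the
strategy attains it at every belief. -/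
theorem StationaryStrategy.isOptimal_of_envelope {r : Ω → ℝ} {δ : ℝ} (hδ0 : 0 ≤ δ) (hδ1 : δ < 1)
    {φ : Belief Ω → Belief Ω} (hφ : Measurable φ) (s : StationaryStrategy Ω)
    (hL : ∀ ℓ ∈ L, 0 ≤ ℓ) (hne : L.Nonempty)
    (hsuper : ∀ q : Belief Ω, ∀ ℓ ∈ L,
      reward r δ φ (fun p => envelope L p.1) q ≤ q.1 ⬝ᵥ ℓ)
    (hattain : ∀ p, envelope L p.1 ≤
      ∫ q, reward r δ φ (fun p => envelope L p.1) q ∂s.kernel p) (p₁ : Belief Ω) :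
    (s.toStrategy hφ p₁).IsOptimal r δ := by
  obtain ⟨ℓ₀, hℓ₀⟩ := hne
  have hW0 : ∀ p : Belief Ω, 0 ≤ envelope L p.1 := fun p => envelope_nonneg hL p.2.1
  have hWK : ∀ p : Belief Ω, envelope L p.1 ≤ ∑ ω, ℓ₀ ω := fun p => by
    refine (envelope_le hL p.2.1 hℓ₀).trans (Finset.sum_le_sum fun ω _ => ?_)
    refine mul_le_of_le_one_left (hL ℓ₀ hℓ₀ ω) ?_
    rw [← p.2.2]
    exact Finset.single_le_sum (fun i _ => p.2.1 i) (Finset.mem_univ ω)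
  intro τ
  refine (τ.payoff_le hδ0 hδ1 hφ (measurable_envelope hL) hW0 hWK fun n h => ?_).trans
    ((s.toStrategy hφ p₁).le_payoff hδ0 hδ1 hφ (measurable_envelope hL) hW0 hWK fun n h => ?_)
  · exact integral_le_envelope ⟨ℓ₀, hℓ₀⟩ (τ.splitting n h)
      (integrable_of_bounded (measurable_reward hφ (measurable_envelope hL))
        (abs_reward_le hδ0 hδ1 hW0 hWK)) hsuper
  · exact hattain _

end Envelope

/-! ### Beliefs as normalized vectors -/

section Greedy

variable {Ω : Type*} [Fintype Ω]

open Classical in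
/-- The belief proportional to a nonzero vector with nonnegative entries; the default value `d`
is returned for all other vectors. -/
noncomputable def normalize (d : Belief Ω) (x : Ω → ℝ) : Belief Ω :=
  ⟨if 0 ≤ x ∧ 0 < ∑ ω, x ω then (∑ ω, x ω)⁻¹ • x else d.1, by
    split_ifs with h
    · refine ⟨fun ω => mul_nonneg (inv_nonneg.2 h.2.le) (h.1 ω), ?_⟩
      simp only [Pi.smul_apply, smul_eq_mul, ← Finset.mul_sum]
      exact inv_mul_cancel₀ h.2.ne'
    · exact d.2⟩

theorem sum_smul_normalize (d : Belief Ω) {x : Ω → ℝ} (hx : 0 ≤ x) :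
    (∑ ω, x ω) • (normalize d x).1 = x := by
  rcases (Finset.sum_nonneg fun ω _ => hx ω).eq_or_lt with h | h
  · have h0 := (Finset.sum_eq_zero_iff_of_nonneg fun ω _ => hx ω).1 h.symm
    rw [← h, zero_smul]
    exact (funext fun ω => h0 ω (Finset.mem_univ ω)).symm
  · simp only [normalize, if_pos (And.intro hx h), smul_smul, mul_inv_cancel₀ h.ne', one_smul]

theorem measurable_normalize (d : Belief Ω) : Measurable (normalize d) := by
  classical
  refine Measurable.subtype_mk (Measurable.ite ?_ ?_ measurable_const)
  · exact (measurableSet_le measurable_const measurable_id).inter (measurableSet_lt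
      (f := fun _ : Ω → ℝ => (0 : ℝ)) (g := fun x : Ω → ℝ => ∑ ω, x ω) measurable_const
      (Finset.measurable_sum _ fun ω _ => measurable_pi_apply ω))
  · exact (Finset.measurable_sum _ fun ω _ => measurable_pi_apply ω).inv.smul measurable_id

theorem expPayoff_eq_dotProduct (r : Ω → ℝ) (p : Belief Ω) : expPayoff r p = p.1 ⬝ᵥ r := rfl

theorem normalize_mem_investRegion {r : Ω → ℝ} {d : Belief Ω} (hd : d ∈ investRegion r)
    {x : Ω → ℝ} (hx : 0 ≤ x ⬝ᵥ r) : normalize d x ∈ investRegion r := by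
  rw [investRegion, Set.mem_ofPred_eq, expPayoff_eq_dotProduct, normalize]
  split_ifs with h
  · rw [smul_dotProduct]
    exact mul_nonneg (inv_nonneg.2 h.2.le) hx
  · exact hd

/-- A vector `g ≤ p` of nonnegative expected payoff is the invested part of a feasible splitting
at `p`, in which investment has probability the total mass of `g`. -/
theorem isFeasible_normalize {r : Ω → ℝ} {d : Belief Ω} (hd : d ∈ investRegion r)
    {p : Belief Ω} {g : Ω → ℝ} (hg0 : 0 ≤ g) (hgp : g ≤ p.1) (hgr : 0 ≤ g ⬝ᵥ r) :
    IsFeasible r p (∑ ω, g ω) (1 - ∑ ω, g ω) (normalize d g) (normalize d (p.1 - g)) := by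
  have hs : ∑ ω, (p.1 - g) ω = 1 - ∑ ω, g ω := by
    simp [Finset.sum_sub_distrib, p.2.2]
  refine ⟨?_, normalize_mem_investRegion hd hgr, by ring,
    Finset.sum_nonneg fun ω _ => hg0 ω, ?_⟩
  · rw [← hs, sum_smul_normalize d hg0, sum_smul_normalize d (sub_nonneg.2 hgp)]
    abel
  · rw [← hs]
    exact Finset.sum_nonneg fun ω _ => sub_nonneg.2 (hgp ω)

theorem IsFeasible.invested_nonneg {r : Ω → ℝ} {p qI qJ : Belief Ω} {aI aJ : ℝ}
    (h : IsFeasible r p aI aJ qI qJ) : 0 ≤ aI • qI.1 :=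
  smul_nonneg h.2.2.2.1 qI.2.1

theorem IsFeasible.rest_nonneg {r : Ω → ℝ} {p qI qJ : Belief Ω} {aI aJ : ℝ}
    (h : IsFeasible r p aI aJ qI qJ) : 0 ≤ aJ • qJ.1 :=
  smul_nonneg h.2.2.2.2 qJ.2.1

theorem div_neg_mul_cancel {x b : ℝ} (hb : b < 0) : x / -b * b = -x := by
  rw [div_neg, neg_mul, div_mul_cancel₀ _ hb.ne]

theorem sum_smul_belief (a : ℝ) (q : Belief Ω) : ∑ ω, (a • q.1) ω = a := by
  simp only [Pi.smul_apply, smul_eq_mul, ← Finset.mul_sum]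
  rw [q.2.2, mul_one]

/-! ### Exchange arguments for greedy splittings -/

section Structure

variable {r : Ω → ℝ} {p qI qJ : Belief Ω} {aI aJ : ℝ} (h : IsGreedySplitting r p aI aJ qI qJ)
include h

theorem IsGreedySplitting.sum_le {g : Ω → ℝ} (hg0 : 0 ≤ g) (hgp : g ≤ p.1) (hgr : 0 ≤ g ⬝ᵥ r) :
    ∑ ω, g ω ≤ aI :=
  h.2 _ _ _ _ (isFeasible_normalize h.1.2.1 hg0 hgp hgr)

theorem IsGreedySplitting.rest_sum_le {g : Ω → ℝ} (hg0 : 0 ≤ aI • qI.1 + g)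
    (hgp : g ≤ aJ • qJ.1) (hgr : 0 ≤ (aI • qI.1 + g) ⬝ᵥ r) : ∑ ω, g ω ≤ 0 := by
  have h1 := h.sum_le hg0 (by rw [h.1.1]; gcongr) hgr
  simp only [Pi.add_apply, Finset.sum_add_distrib] at h1
  rw [sum_smul_belief] at h1
  linarith

theorem IsGreedySplitting.invested_payoff_nonneg : 0 ≤ (aI • qI.1) ⬝ᵥ r := by
  rw [smul_dotProduct]
  exact mul_nonneg h.1.2.2.2.1 h.1.2.1

/-- Outside the investment region, a greedy splitting uses up the whole expected payoff. -/
theorem IsGreedySplitting.invested_payoff_eq_zero (hp : p ∉ investRegion r) :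
    (aI • qI.1) ⬝ᵥ r = 0 := by
  have hp' : p.1 ⬝ᵥ r < 0 := not_le.1 hp
  rw [h.1.1, add_dotProduct] at hp'
  refine le_antisymm (not_lt.1 fun hpos => ?_) h.invested_payoff_nonneg
  set y := (aI • qI.1) ⬝ᵥ r with hy
  set z := (aJ • qJ.1) ⬝ᵥ r with hz
  have hz0 : z < 0 := by linarith
  -- the share of the remaining mass that can still be afforded
  have ht0 : 0 < y / -z := div_pos hpos (neg_pos.2 hz0)
  have ht1 : y / -z ≤ 1 := (div_le_one (neg_pos.2 hz0)).2 (by linarith)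
  have h1 := h.rest_sum_le (g := (y / -z) • (aJ • qJ.1))
    (add_nonneg h.1.invested_nonneg (smul_nonneg ht0.le h.1.rest_nonneg))
    (fun ω => mul_le_of_le_one_left (h.1.rest_nonneg ω) ht1) (by
      rw [add_dotProduct, smul_dotProduct (y / -z), ← hy, ← hz, smul_eq_mul,
        div_neg_mul_cancel hz0, add_neg_cancel])
  rw [smul_smul, sum_smul_belief] at h1
  have hJ : aJ ≤ 0 := by
    by_contra hcon
    exact absurd h1 (not_le.2 (mul_pos ht0 (not_le.1 hcon)))
  have hJ0 : aJ = 0 := le_antisymm hJ h.1.2.2.2.2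
  rw [hJ0, zero_smul, zero_dotProduct] at hz
  exact hz0.ne hz

variable [DecidableEq Ω]

/-- A greedy splitting invests all the mass of the states with nonnegative payoff. -/
theorem IsGreedySplitting.rest_eq_zero_of_nonneg {ω : Ω} (hω : 0 ≤ r ω) :
    (aJ • qJ.1) ω = 0 := by
  have h0 := h.1.rest_nonneg ω
  refine le_antisymm ?_ h0
  have h1 := h.rest_sum_le (g := Pi.single ω ((aJ • qJ.1) ω))
    (add_nonneg h.1.invested_nonneg (Pi.single_nonneg.2 h0)) (fun j => ?_) (by
      rw [add_dotProduct, single_dotProduct]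
      exact add_nonneg h.invested_payoff_nonneg (mul_nonneg h0 hω))
  · simpa using h1
  · rcases eq_or_ne j ω with rfl | hj
    · simp
    · rw [Pi.single_eq_of_ne hj]
      exact h.1.rest_nonneg j

/-- A greedy splitting does not invest any mass of a costly state `C` before all the mass of a
cheaper state `B` is invested: else, exchanging mass of `C` against mass of `B` would increase the
probability of investment. -/
theorem IsGreedySplitting.invested_eq_zero_or_rest_eq_zero {B C : Ω} (hB : r B < 0)
    (hBC : r C < r B) : (aI • qI.1) C = 0 ∨ (aJ • qJ.1) B = 0 := by
  by_contra! hcon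
  have hC0 : 0 < (aI • qI.1) C := (h.1.invested_nonneg C).lt_of_ne' hcon.1
  have hB0 : 0 < (aJ • qJ.1) B := (h.1.rest_nonneg B).lt_of_ne' hcon.2
  have hne : C ≠ B := fun e => hBC.ne (by rw [e])
  set c := (aI • qI.1) C with hc
  set b := (aJ • qJ.1) B with hb
  have hC : r C < 0 := hBC.trans hB
  -- `ε` units of payoff are transferred
  obtain ⟨ε, hε0, hεc, hεb⟩ : ∃ ε : ℝ, 0 < ε ∧ ε / -r C ≤ c ∧ ε / -r B ≤ b := by
    refine ⟨min (c * -r C) (b * -r B), lt_min (mul_pos hC0 (neg_pos.2 hC))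
      (mul_pos hB0 (neg_pos.2 hB)), ?_, ?_⟩
    · exact (div_le_iff₀ (neg_pos.2 hC)).2 (min_le_left _ _)
    · exact (div_le_iff₀ (neg_pos.2 hB)).2 (min_le_right _ _)
  have h1 := h.rest_sum_le (g := Pi.single B (ε / -r B) - Pi.single C (ε / -r C))
    (fun j => ?_) (fun j => ?_) ?_
  · have h2 : ε / -r C < ε / -r B :=
      div_lt_div_of_pos_left hε0 (neg_pos.2 hB) (neg_lt_neg hBC)
    simp only [Pi.sub_apply, Finset.sum_sub_distrib, Finset.sum_pi_single', Finset.mem_univ,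
      if_true] at h1
    linarith
  · have hj := h.1.invested_nonneg j
    simp only [Pi.add_apply, Pi.sub_apply, Pi.zero_apply] at hj ⊢
    have h3 : (0 : Ω → ℝ) ≤ Pi.single B (ε / -r B) :=
      Pi.single_nonneg.2 (div_nonneg hε0.le (neg_pos.2 hB).le)
    have h4 := h3 j
    rw [Pi.zero_apply] at h4
    rcases eq_or_ne j C with rfl | hjC
    · rw [Pi.single_eq_same]
      linarith
    · rw [Pi.single_eq_of_ne hjC]
      linarith
  · have hj := h.1.rest_nonneg j
    simp only [Pi.sub_apply, Pi.zero_apply] at hj ⊢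
    have h3 : (0 : Ω → ℝ) ≤ Pi.single C (ε / -r C) :=
      Pi.single_nonneg.2 (div_nonneg hε0.le (neg_pos.2 hC).le)
    have h4 := h3 j
    rw [Pi.zero_apply] at h4
    rcases eq_or_ne j B with rfl | hjB
    · rw [Pi.single_eq_same]
      linarith
    · rw [Pi.single_eq_of_ne hjB]
      linarith
  · rw [add_dotProduct, sub_dotProduct, single_dotProduct, single_dotProduct]
    rw [div_neg_mul_cancel hB, div_neg_mul_cancel hC]
    have := h.invested_payoff_nonneg
    linarith

end Structure

/-! ### Existence of greedy strategies -/

section Existence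

variable {r : Ω → ℝ}

/-- A measurable selection of vectors that solve the greedy problem, expressed through the invested
mass, yields a greedy stationary strategy. -/
theorem exists_isGreedy_of_selection {d : Belief Ω} (hd : d ∈ investRegion r)
    (f : Belief Ω → Ω → ℝ) (hf : Measurable f)
    (hfeas : ∀ p ∉ investRegion r, 0 ≤ f p ∧ f p ≤ p.1 ∧ 0 ≤ f p ⬝ᵥ r)
    (hmax : ∀ p ∉ investRegion r, ∀ g : Ω → ℝ, 0 ≤ g → g ≤ p.1 → 0 ≤ g ⬝ᵥ r →
      ∑ ω, g ω ≤ ∑ ω, f p ω) :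
    ∃ s : StationaryStrategy Ω, s.IsGreedy r := by
  classical
  let a : Belief Ω → ℝ := fun p => ∑ ω, f p ω
  let u : Belief Ω → Belief Ω := fun p => normalize d (f p)
  let v : Belief Ω → Belief Ω := fun p => normalize d (p.1 - f p)
  have ha : Measurable a := Finset.measurable_sum _ fun ω _ => (measurable_pi_apply ω).comp hf
  have hu : Measurable u := (measurable_normalize d).comp hf
  have hv : Measurable v := (measurable_normalize d).comp (measurable_subtype_coe.sub hf)
  have hgs : ∀ p ∉ investRegion r, IsGreedySplitting r p (a p) (1 - a p) (u p) (v p) := by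
    intro p hp
    refine ⟨isFeasible_normalize hd (hfeas p hp).1 (hfeas p hp).2.1 (hfeas p hp).2.2,
      fun bI bJ uI uJ hb => ?_⟩
    have h1 := hmax p hp (bI • uI.1) hb.invested_nonneg
      (by rw [hb.1]; exact le_add_of_nonneg_right hb.rest_nonneg)
      (by rw [smul_dotProduct]; exact mul_nonneg hb.2.2.2.1 hb.2.1)
    rwa [sum_smul_belief] at h1
  let κ : Kernel (Belief Ω) (Belief Ω) :=
    ⟨fun p => if p ∈ investRegion r then Measure.dirac p else
      ENNReal.ofReal (a p) • Measure.dirac (u p) +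
        ENNReal.ofReal (1 - a p) • Measure.dirac (v p), by
      refine Measurable.ite (measurableSet_investRegion r) Measure.measurable_dirac ?_
      refine Measure.measurable_of_measurable_coe _ fun S hS => ?_
      simp only [Measure.add_apply, Measure.smul_apply, smul_eq_mul]
      exact (ha.ennreal_ofReal.mul ((Measure.measurable_coe hS).comp
        (Measure.measurable_dirac.comp hu))).add
        ((measurable_const.sub ha).ennreal_ofReal.mul ((Measure.measurable_coe hS).comp
        (Measure.measurable_dirac.comp hv)))⟩
  have hκ1 : ∀ p ∈ investRegion r, κ p = Measure.dirac p := fun p hp => if_pos hp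
  have hκ2 : ∀ p ∉ investRegion r, κ p = ENNReal.ofReal (a p) • Measure.dirac (u p) +
        ENNReal.ofReal (1 - a p) • Measure.dirac (v p) := fun p hp => if_neg hp
  refine ⟨⟨κ, fun p => ?_⟩, hκ1, fun p hp => ⟨_, _, _, _, hgs p hp, hκ2 p hp⟩⟩
  by_cases hp : p ∈ investRegion r
  · rw [hκ1 p hp]
    exact ⟨Measure.dirac.isProbabilityMeasure, fun ω => integral_dirac _ _⟩
  · obtain ⟨h1, -, h2, h3, h4⟩ := (hgs p hp).1
    rw [hκ2 p hp]
    refine ⟨⟨?_⟩, fun ω => ?_⟩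
    · simp only [Measure.add_apply, Measure.smul_apply, measure_univ, smul_eq_mul, mul_one]
      rw [← ENNReal.ofReal_add h3 h4, h2, ENNReal.ofReal_one]
    · have hi : ∀ q : Belief Ω, Integrable (fun q : Belief Ω => q.1 ω) (Measure.dirac q) :=
        fun q => ((continuous_apply ω).comp
          continuous_subtype_val).integrable_of_hasCompactSupport
            (HasCompactSupport.of_compactSpace _)
      rw [integral_add_measure ((hi _).smul_measure ENNReal.ofReal_ne_top)
        ((hi _).smul_measure ENNReal.ofReal_ne_top), integral_smul_measure, integral_smul_measure,
        integral_dirac, integral_dirac, ENNReal.toReal_ofReal h3, ENNReal.toReal_ofReal h4, h1]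
      rfl

/-- Existence of greedy strategies for three states: all the mass of `A` is invested, then as much
of the mass of `B` as can be afforded, and then as much of the mass of `C`. -/
theorem exists_isGreedy [DecidableEq Ω] {A B C : Ω} (huniv : Finset.univ = {A, B, C})
    (hAB : A ≠ B) (hAC : A ≠ C) (hBC : B ≠ C) (hA : 0 ≤ r A) (hC : r C < 0) (hCB : r C ≤ r B) :
    ∃ s : StationaryStrategy Ω, s.IsGreedy r := by
  have hsum : ∀ x : Ω → ℝ, ∑ ω, x ω = x A + x B + x C := fun x => by
    rw [huniv, Finset.sum_insert (by simp [hAB, hAC]), Finset.sum_pair hBC, add_assoc]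
  have hdot : ∀ x : Ω → ℝ, x ⬝ᵥ r = x A * r A + x B * r B + x C * r C := fun x => hsum _
  have hall : ∀ ω, ω = A ∨ ω = B ∨ ω = C := fun ω => by
    simpa [huniv] using Finset.mem_univ ω
  have hle : ∀ x x' : Ω → ℝ, x A ≤ x' A → x B ≤ x' B → x C ≤ x' C → x ≤ x' := by
    intro x x' h1 h2 h3 ω
    rcases hall ω with rfl | rfl | rfl <;> assumption
  let b : Belief Ω → ℝ := fun p =>
    if 0 ≤ r B then p.1 B else min (p.1 B) (p.1 A * (r A / -r B))
  have hcoord : ∀ ω, Measurable fun p : Belief Ω => p.1 ω := fun ω =>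
    (measurable_pi_apply ω).comp measurable_subtype_coe
  have hb : Measurable b := by
    by_cases hB : 0 ≤ r B
    · simpa only [b, if_pos hB] using hcoord B
    · simpa only [b, if_neg hB] using (hcoord B).min ((hcoord A).mul_const _)
  let f : Belief Ω → Ω → ℝ := fun p ω =>
    if ω = A then p.1 A else if ω = B then b p else (p.1 A * r A + b p * r B) / -r C
  have hfA : ∀ p, f p A = p.1 A := fun p => if_pos rfl
  have hfB : ∀ p, f p B = b p := fun p => by simp only [f, if_neg hAB.symm, if_true]
  have hfC : ∀ p, f p C = (p.1 A * r A + b p * r B) / -r C := fun p => by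
    simp only [f, if_neg hAC.symm, if_neg hBC.symm]
  have hf : Measurable f := by
    refine measurable_pi_lambda _ fun ω => ?_
    rcases hall ω with rfl | rfl | rfl
    · simpa only [hfA] using hcoord _
    · simpa only [hfB] using hb
    · simp only [hfC]
      exact (((hcoord A).mul_const _).add (hb.mul_const _)).div_const _
  have hCpos : 0 < -r C := neg_pos.2 hC
  have hfCmul : ∀ p, f p C * r C = -(p.1 A * r A + b p * r B) := fun p => by
    rw [hfC, div_neg_mul_cancel hC]
  have hpay : ∀ p, f p ⬝ᵥ r = 0 := fun p => by
    rw [hdot, hfA, hfB, hfCmul]; ring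
  -- either the mass of `B` is exhausted, or the budget is
  have hbcase : ∀ p, 0 ≤ b p ∧ b p ≤ p.1 B ∧
      0 ≤ p.1 A * r A + b p * r B ∧
      (b p = p.1 B ∨ (r B < 0 ∧ p.1 A * r A + b p * r B = 0)) := by
    intro p
    have pA : 0 ≤ p.1 A := p.2.1 A
    have pB : 0 ≤ p.1 B := p.2.1 B
    by_cases hB : 0 ≤ r B
    · have hbp : b p = p.1 B := if_pos hB
      rw [hbp]
      exact ⟨pB, le_rfl, add_nonneg (mul_nonneg pA hA) (mul_nonneg pB hB), Or.inl rfl⟩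
    · have hbp : b p = min (p.1 B) (p.1 A * (r A / -r B)) := if_neg hB
      have hB' : r B < 0 := not_le.1 hB
      have hBpos : 0 < -r B := neg_pos.2 hB'
      have e : p.1 A * (r A / -r B) * r B = -(p.1 A * r A) := by
        rw [mul_assoc, div_neg_mul_cancel hB', mul_neg]
      refine ⟨?_, ?_, ?_, ?_⟩
      · rw [hbp]
        exact le_min pB (mul_nonneg pA (div_nonneg hA hBpos.le))
      · rw [hbp]
        exact min_le_left _ _
      · have h1 : b p ≤ p.1 A * (r A / -r B) := by rw [hbp]; exact min_le_right _ _
        nlinarith [mul_le_mul_of_nonpos_right h1 hB'.le]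
      · rcases min_choice (p.1 B) (p.1 A * (r A / -r B)) with h1 | h1
        · exact Or.inl (hbp.trans h1)
        · refine Or.inr ⟨hB', ?_⟩
          rw [hbp, h1, e]
          ring
  refine exists_isGreedy_of_selection (d := ⟨Pi.single A 1, single_mem_stdSimplex ℝ A⟩) ?_ f hf
    ?_ ?_
  · change 0 ≤ (Pi.single A 1 : Ω → ℝ) ⬝ᵥ r
    simpa using hA
  · intro p hp
    obtain ⟨hb0, hbB, hbud, hor⟩ := hbcase p
    have hp' : p.1 ⬝ᵥ r < 0 := not_le.1 hp
    rw [hdot] at hp'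
    refine ⟨hle _ _ ?_ ?_ ?_, hle _ _ ?_ ?_ ?_, (hpay p).ge⟩
    · rw [hfA]; exact p.2.1 A
    · rw [hfB]; exact hb0
    · rw [hfC]; exact div_nonneg hbud hCpos.le
    · rw [hfA]
    · rw [hfB]; exact hbB
    · rw [hfC, div_le_iff₀ hCpos]
      rcases hor with h1 | ⟨-, h1⟩
      · rw [h1]; linarith
      · rw [h1]; exact mul_nonneg (p.2.1 C) hCpos.le
  · intro p hp g hg0 hgp hgr
    obtain ⟨hb0, hbB, hbud, hor⟩ := hbcase p
    rw [hdot] at hgr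
    rw [hsum, hsum, hfA, hfB]
    have gA : 0 ≤ g A := hg0 A
    have gB : 0 ≤ g B := hg0 B
    have gC : 0 ≤ g C := hg0 C
    have gA' := hgp A
    have gB' := hgp B
    have key := hfCmul p
    rcases hor with h1 | ⟨hB, h1⟩
    · -- multiply the inequality by the cost of `C`
      rw [h1] at key ⊢
      refine le_of_mul_le_mul_right ?_ hCpos
      nlinarith [mul_nonneg (sub_nonneg.2 gA') (by linarith : 0 ≤ r A - r C),
        mul_nonneg (sub_nonneg.2 gB') (by linarith : 0 ≤ r B - r C)]
    · -- multiply the inequality by the cost of `B`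
      have hc0 : f p C = 0 := by rw [hfC, h1, zero_div]
      rw [hc0]
      refine le_of_mul_le_mul_right ?_ (neg_pos.2 hB)
      nlinarith [mul_nonneg (sub_nonneg.2 gA') (by linarith : 0 ≤ r A - r B),
        mul_nonneg gC (sub_nonneg.2 hCB)]

end Existence

end Greedy

/-! ### Families of functionals of mass and payoff -/

section Reduced

/-- A pair `b` stands for the functional `b.1 * n + b.2 * y` of the mass `n` and of the payoff `y`
of a vector. The drift moves `(n, y)` to `(n, lam * y + (1 - lam) * μ * n)`, where `μ` is the payoff
of the invariant distribution, and `-γ` is the least payoff of a state. The fields say that the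
lower envelope of the family `F` solves the Bellman equation of the problem in which only `y`
matters; the pair `(v, s)` is the member of `F` that is minimal at `y ≤ 0`. -/
structure IsReducedFamily (δ lam μ γ v s : ℝ) (F : Set (ℝ × ℝ)) : Prop where
  base_mem : (v, s) ∈ F
  base_nonneg : s * γ ≤ v
  slope_nonneg : 0 ≤ s
  const_le : ∀ b ∈ F, v ≤ b.1
  slope_mem : ∀ b ∈ F, 0 ≤ b.2 ∧ b.2 ≤ s
  /-- The envelope dominates investing in the current round. -/
  invest_le : ∀ b ∈ F, ∃ b' ∈ F, ∀ n y : ℝ, 0 ≤ n → 0 ≤ y →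
    (1 - δ) * n + δ * (b'.1 * n + b'.2 * (lam * y + (1 - lam) * μ * n)) ≤ b.1 * n + b.2 * y
  /-- In the investment region, investing attains the envelope. -/
  le_invest : ∀ b ∈ F, ∃ b' ∈ F, ∀ n y : ℝ, 0 ≤ n → 0 ≤ y →
    b'.1 * n + b'.2 * y ≤ (1 - δ) * n + δ * (b.1 * n + b.2 * (lam * y + (1 - lam) * μ * n))
  /-- The envelope dominates waiting for one round. -/
  wait_le : ∃ b ∈ F, ∀ n y : ℝ, 0 ≤ n → -γ * n ≤ y →
    δ * (b.1 * n + b.2 * (lam * y + (1 - lam) * μ * n)) ≤ v * n + s * y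
  /-- At the worst state, waiting attains the envelope. -/
  le_wait : ∀ b ∈ F, v - s * γ ≤ δ * (b.1 + b.2 * (lam * -γ + (1 - lam) * μ))
  const_eq_or : (∀ b ∈ F, b.1 = v) ∨ μ ≤ 0

variable {δ lam μ γ : ℝ}

/-- If the invariant distribution lies in the investment region, this region is absorbing, so that
the value is `min 1 (1 + s * y)`. -/
theorem isReducedFamily_of_nonneg (hδ0 : 0 ≤ δ) (hδ1 : δ < 1) (hl0 : 0 ≤ lam) (hl1 : lam < 1)
    (hγ : 0 < γ) (hμ : 0 ≤ μ) :
    ∃ s, IsReducedFamily δ lam μ γ 1 s {(1, 0), (1, s)} := by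
  set κ := min 0 (lam * -γ + (1 - lam) * μ) with hκ
  have hκ0 : κ ≤ 0 := min_le_left _ _
  have hκ1 : κ ≤ lam * -γ + (1 - lam) * μ := min_le_right _ _
  have hlμ : 0 ≤ (1 - lam) * μ := mul_nonneg (sub_nonneg.2 hl1.le) hμ
  have hκ2 : -(lam * γ) ≤ κ := le_min (by nlinarith) (by linarith)
  have hlγ : lam * γ ≤ γ := mul_le_of_le_one_left hγ.le hl1.le
  have hD : 0 < γ + δ * κ := by
    have h1 : δ * -γ ≤ δ * κ := mul_le_mul_of_nonneg_left (by linarith) hδ0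
    nlinarith
  obtain ⟨s, hs⟩ : ∃ s, s = (1 - δ) / (γ + δ * κ) := ⟨_, rfl⟩
  have hs0 : 0 ≤ s := by rw [hs]; exact div_nonneg (by linarith) hD.le
  -- the value at the worst state is the discounted value after one round
  have hfix : 1 - s * γ = δ * (1 + s * κ) := by
    have : s * (γ + δ * κ) = 1 - δ := by rw [hs]; exact div_mul_cancel₀ _ hD.ne'
    linarith
  have hsγ : s * γ ≤ 1 := by
    have h1 : 0 ≤ s * (γ + κ) := mul_nonneg hs0 (by linarith)
    have h2 : 0 ≤ 1 + s * κ := by nlinarith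
    have := mul_nonneg hδ0 h2
    linarith
  refine ⟨s, ?_, hsγ, hs0, ?_, ?_, ?_, ?_, ?_, ?_, Or.inl ?_⟩
  · simp
  · rintro b (rfl | rfl) <;> exact le_rfl
  · rintro b (rfl | rfl)
    exacts [⟨le_rfl, hs0⟩, ⟨hs0, le_rfl⟩]
  · rintro b (rfl | rfl) <;> refine ⟨(1, 0), Or.inl rfl, fun n y hn hy => ?_⟩
    · simp only; linarith
    · have := mul_nonneg hs0 hy
      simp only; linarith
  · rintro b (rfl | rfl) <;> refine ⟨(1, 0), Or.inl rfl, fun n y hn hy => ?_⟩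
    · simp only; linarith
    · have h1 : 0 ≤ s * (lam * y + (1 - lam) * μ * n) :=
        mul_nonneg hs0 (add_nonneg (mul_nonneg hl0 hy) (mul_nonneg hlμ hn))
      have := mul_nonneg hδ0 h1
      simp only; linarith
  · rcases min_choice 0 (lam * -γ + (1 - lam) * μ) with h | h
    · refine ⟨(1, 0), Or.inl rfl, fun n y hn hy => ?_⟩
      have hk : κ = 0 := h
      rw [hk, mul_zero, add_zero] at hfix
      have := mul_le_mul_of_nonneg_left hy hs0
      have h2 : s * γ * n = (1 - δ) * n := by rw [show s * γ = 1 - δ by linarith]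
      simp only; linarith
    · refine ⟨(1, s), Or.inr rfl, fun n y hn hy => ?_⟩
      have hk : κ = lam * -γ + (1 - lam) * μ := h
      have h1 : 0 ≤ s * (1 - δ * lam) :=
        mul_nonneg hs0 (by nlinarith)
      have h2 := mul_nonneg h1 (by linarith : 0 ≤ y + γ * n)
      have h3 : (1 - s * γ) * n = δ * (1 + s * κ) * n := by rw [hfix]
      rw [hk] at h3
      simp only
      linarith
  · rintro b (rfl | rfl)
    · have h1 := mul_nonneg hδ0 (mul_nonneg hs0 (neg_nonneg.2 hκ0))
      simp only; linarith
    · have h1 := mul_le_mul_of_nonneg_left (mul_le_mul_of_nonneg_left hκ1 hs0) hδ0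
      simp only; linarith
  · rintro b (rfl | rfl) <;> rfl

/-- Iterates of the map that expresses investing in the current round, which sends a functional
`b` to `(1 - δ) * n + δ * b` evaluated after the drift. -/
def investIterate (δ lam μ v s : ℝ) : ℕ → ℝ × ℝ
  | 0 => (v, s)
  | k + 1 => (1 - δ + δ * ((investIterate δ lam μ v s k).1 +
      (investIterate δ lam μ v s k).2 * ((1 - lam) * μ)),
      δ * lam * (investIterate δ lam μ v s k).2)

/-- If the invariant distribution has nonpositive payoff, beliefs may leave the investment region
under the drift; the `k`-th functional is the value of investing for `k` rounds before the belief
is treated as one of negative payoff. -/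
theorem isReducedFamily_of_nonpos (hδ0 : 0 ≤ δ) (hδ1 : δ < 1) (hl0 : 0 ≤ lam) (hl1 : lam < 1)
    (hγ : 0 < γ) (hμ : μ ≤ 0) (hμγ : -γ ≤ μ) :
    ∃ v s, IsReducedFamily δ lam μ γ v s (Set.range (investIterate δ lam μ v s)) := by
  have hδl : δ * lam < 1 := by nlinarith
  have hδl0 : 0 ≤ δ * lam := mul_nonneg hδ0 hl0
  have h1δ : 0 < 1 - δ := by linarith
  have hlμ : (1 - lam) * μ ≤ 0 := mul_nonpos_of_nonneg_of_nonpos (by linarith) hμ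
  have hlμγ : 0 ≤ (1 - lam) * (γ + μ) := mul_nonneg (by linarith) (by linarith)
  obtain ⟨s, hs⟩ : ∃ s, s = (1 - δ) / (γ * (1 - δ * lam)) := ⟨_, rfl⟩
  have hD : 0 < γ * (1 - δ * lam) := mul_pos hγ (by linarith)
  have hs0 : 0 ≤ s := by rw [hs]; exact div_nonneg h1δ.le hD.le
  have hs1 : s * (γ * (1 - δ * lam)) = 1 - δ := by rw [hs]; exact div_mul_cancel₀ _ hD.ne'
  obtain ⟨v, hv⟩ : ∃ v, v = 1 + δ * (s * ((1 - lam) * μ)) / (1 - δ) := ⟨_, rfl⟩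
  -- at the frontier, one investment is followed by a belief of nonpositive payoff
  have hv1 : v = 1 - δ + δ * (v + s * ((1 - lam) * μ)) := by
    have : (v - 1) * (1 - δ) = δ * (s * ((1 - lam) * μ)) := by
      rw [hv, add_sub_cancel_left]; exact div_mul_cancel₀ _ h1δ.ne'
    linarith
  have hbase : s * γ ≤ v := by
    have h1 : (v - s * γ) * (1 - δ) = δ * (s * ((1 - lam) * (γ + μ))) := by linarith
    have h2 : 0 ≤ (v - s * γ) * (1 - δ) := by
      rw [h1]; exact mul_nonneg hδ0 (mul_nonneg hs0 hlμγ)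
    linarith [nonneg_of_mul_nonneg_left h2 h1δ]
  set E := investIterate δ lam μ v s with hE
  have hslope : ∀ k, 0 ≤ (E k).2 ∧ (E k).2 ≤ s := fun k => by
    induction k with
    | zero => exact ⟨hs0, le_rfl⟩
    | succ k ih =>
      exact ⟨mul_nonneg hδl0 ih.1, (mul_le_of_le_one_left ih.1 hδl.le).trans ih.2⟩
  have hconst : ∀ k, v ≤ (E k).1 := fun k => by
    induction k with
    | zero => exact le_rfl
    | succ k ih =>
      change v ≤ 1 - δ + δ * ((E k).1 + (E k).2 * ((1 - lam) * μ))
      have h1 := mul_le_mul_of_nonpos_right (hslope k).2 hlμ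
      have h2 := mul_le_mul_of_nonneg_left (add_le_add ih h1) hδ0
      linarith
  have hstep : ∀ k n y, (E (k + 1)).1 * n + (E (k + 1)).2 * y =
      (1 - δ) * n + δ * ((E k).1 * n + (E k).2 * (lam * y + (1 - lam) * μ * n)) := by
    intro k n y
    change (1 - δ + δ * ((E k).1 + (E k).2 * ((1 - lam) * μ))) * n + δ * lam * (E k).2 * y = _
    ring
  refine ⟨v, s, ⟨0, rfl⟩, hbase, hs0, ?_, ?_, ?_, ?_, ?_, ?_, Or.inr hμ⟩
  · rintro _ ⟨k, rfl⟩
    exact hconst k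
  · rintro _ ⟨k, rfl⟩
    exact hslope k
  · rintro _ ⟨k, rfl⟩
    cases k with
    | zero =>
      refine ⟨E 0, ⟨0, rfl⟩, fun n y hn hy => ?_⟩
      change (1 - δ) * n + δ * (v * n + s * (lam * y + (1 - lam) * μ * n)) ≤ v * n + s * y
      have h1 : v * n = (1 - δ + δ * (v + s * ((1 - lam) * μ))) * n := by rw [← hv1]
      have h2 := mul_nonneg (mul_nonneg hs0 (by linarith : 0 ≤ 1 - δ * lam)) hy
      linarith
    | succ k => exact ⟨E k, ⟨k, rfl⟩, fun n y _ _ => (hstep k n y).ge⟩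
  · rintro _ ⟨k, rfl⟩
    exact ⟨E (k + 1), ⟨k + 1, rfl⟩, fun n y _ _ => (hstep k n y).le⟩
  · refine ⟨E 0, ⟨0, rfl⟩, fun n y hn hy => ?_⟩
    change δ * (v * n + s * (lam * y + (1 - lam) * μ * n)) ≤ v * n + s * y
    have h1 : v * n = (1 - δ + δ * (v + s * ((1 - lam) * μ))) * n := by rw [← hv1]
    have h2 := mul_nonneg (mul_nonneg hs0 (by linarith : 0 ≤ 1 - δ * lam))
      (by linarith : 0 ≤ y + γ * n)
    have h3 : s * (γ * (1 - δ * lam)) * n = (1 - δ) * n := by rw [hs1]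
    linarith
  · rintro _ ⟨k, rfl⟩
    have h0 : lam * -γ + (1 - lam) * μ ≤ 0 := by nlinarith
    have h1 := mul_le_mul_of_nonpos_right (hslope k).2 h0
    have h2 := mul_le_mul_of_nonneg_left (add_le_add (hconst k) h1) hδ0
    linarith

theorem exists_isReducedFamily (hδ0 : 0 ≤ δ) (hδ1 : δ < 1) (hl0 : 0 ≤ lam) (hl1 : lam < 1)
    (hγ : 0 < γ) (hμγ : -γ ≤ μ) : ∃ v s F, IsReducedFamily δ lam μ γ v s F := by
  rcases le_total 0 μ with h | h
  · obtain ⟨s, hs⟩ := isReducedFamily_of_nonneg hδ0 hδ1 hl0 hl1 hγ h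
    exact ⟨_, _, _, hs⟩
  · obtain ⟨v, s, hs⟩ := isReducedFamily_of_nonpos hδ0 hδ1 hl0 hl1 hγ h hμγ
    exact ⟨_, _, _, hs⟩

end Reduced

/-! ### The drift as a linear map -/

section LinearDrift

variable {Ω : Type*} [Fintype Ω]

/-- The linear extension to `ℝ^Ω` of the homothety of the simplex with center `m` and
ratio `lam`. -/
def linDrift (lam : ℝ) (m : Belief Ω) (x : Ω → ℝ) : Ω → ℝ :=
  lam • x + ((1 - lam) * ∑ ω, x ω) • m.1

variable {lam : ℝ} {m : Belief Ω}

theorem linDrift_nonneg (hl0 : 0 ≤ lam) (hl1 : lam < 1) {x : Ω → ℝ} (hx : 0 ≤ x) :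
    0 ≤ linDrift lam m x :=
  add_nonneg (smul_nonneg hl0 hx) (smul_nonneg
    (mul_nonneg (sub_nonneg.2 hl1.le) (Finset.sum_nonneg fun ω _ => hx ω)) m.2.1)

theorem linDrift_dotProduct (x ℓ : Ω → ℝ) :
    linDrift lam m x ⬝ᵥ ℓ = lam * (x ⬝ᵥ ℓ) + (1 - lam) * (∑ ω, x ω) * (m.1 ⬝ᵥ ℓ) := by
  simp only [linDrift, add_dotProduct, smul_dotProduct, smul_eq_mul]

theorem linDrift_smul (a : ℝ) (x : Ω → ℝ) :
    linDrift lam m (a • x) = a • linDrift lam m x := by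
  ext ω
  simp only [linDrift, Pi.add_apply, Pi.smul_apply, smul_eq_mul, ← Finset.mul_sum]
  ring

theorem sum_linDrift (x : Ω → ℝ) : ∑ ω, linDrift lam m x ω = ∑ ω, x ω := by
  simp only [linDrift, Pi.add_apply, Pi.smul_apply, smul_eq_mul, Finset.sum_add_distrib,
    ← Finset.mul_sum]
  rw [m.2.2]
  ring

variable {r : Ω → ℝ} {δ : ℝ} {φ : Belief Ω → Belief Ω} {L : Set (Ω → ℝ)}

/-- The optimality criterion for greedy strategies, in homogeneous form: the vectors `aI • qI` and
`aJ • qJ` play the role of the invested part and of the remaining part of a belief. -/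
theorem isOptimal_of_isGreedy (hδ0 : 0 ≤ δ) (hδ1 : δ < 1) (hφ : Measurable φ)
    (hlin : ∀ p, (φ p).1 = linDrift lam m p.1)
    (hL : ∀ ℓ ∈ L, 0 ≤ ℓ) (hne : L.Nonempty)
    (hinv : ∀ ℓ ∈ L, ∀ x : Ω → ℝ, 0 ≤ x → 0 ≤ x ⬝ᵥ r →
      (1 - δ) * ∑ ω, x ω + δ * envelope L (linDrift lam m x) ≤ x ⬝ᵥ ℓ)
    (hwait : ∀ ℓ ∈ L, ∀ x : Ω → ℝ, 0 ≤ x → x ⬝ᵥ r ≤ 0 →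
      δ * envelope L (linDrift lam m x) ≤ x ⬝ᵥ ℓ)
    (hinv' : ∀ x : Ω → ℝ, 0 ≤ x → 0 ≤ x ⬝ᵥ r →
      envelope L x ≤ (1 - δ) * ∑ ω, x ω + δ * envelope L (linDrift lam m x))
    (hgreedy : ∀ p ∉ investRegion r, ∀ (aI aJ : ℝ) (qI qJ : Belief Ω),
      IsGreedySplitting r p aI aJ qI qJ → envelope L (aI • qI.1 + aJ • qJ.1) ≤
        (1 - δ) * ∑ ω, (aI • qI.1) ω + δ * envelope L (linDrift lam m (aI • qI.1)) +
          δ * envelope L (linDrift lam m (aJ • qJ.1)))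
    (s : StationaryStrategy Ω) (hs : s.IsGreedy r) (p₁ : Belief Ω) :
    (s.toStrategy hφ p₁).IsOptimal r δ := by
  have hrI : ∀ q ∈ investRegion r, reward r δ φ (fun p => envelope L p.1) q =
      (1 - δ) + δ * envelope L (linDrift lam m q.1) := fun q hq => by
    simp only [reward, Set.indicator_of_mem hq, Pi.one_apply, mul_one, hlin]
  have hrJ : ∀ q ∉ investRegion r, reward r δ φ (fun p => envelope L p.1) q =
      δ * envelope L (linDrift lam m q.1) := fun q hq => by
    simp only [reward, Set.indicator_of_notMem hq, mul_zero, zero_add, hlin]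
  have hsm : Measurable (reward r δ φ fun p => envelope L p.1) :=
    measurable_reward hφ (measurable_envelope hL)
  have hrJ' : ∀ q, δ * envelope L (linDrift lam m q.1) ≤
      reward r δ φ (fun p => envelope L p.1) q := fun q => by
    by_cases hq : q ∈ investRegion r
    · rw [hrI q hq]; linarith
    · rw [hrJ q hq]
  refine s.isOptimal_of_envelope hδ0 hδ1 hφ hL hne (fun q ℓ hℓ => ?_) (fun p => ?_) p₁
  · by_cases hq : q ∈ investRegion r
    · have h1 := hinv ℓ hℓ q.1 q.2.1 hq
      rw [q.2.2, mul_one] at h1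
      rwa [hrI q hq]
    · rw [hrJ q hq]
      exact hwait ℓ hℓ q.1 q.2.1 (not_le.1 hq).le
  · by_cases hp : p ∈ investRegion r
    · have h1 := hinv' p.1 p.2.1 hp
      rw [p.2.2, mul_one] at h1
      rwa [hs.1 p hp, integral_dirac' _ _ hsm.stronglyMeasurable, hrI p hp]
    · obtain ⟨aI, aJ, qI, qJ, hg, hk⟩ := hs.2 p hp
      have h1 := hgreedy p hp aI aJ qI qJ hg
      obtain ⟨⟨h2, h3, -, h4, h5⟩, -⟩ := hg
      have hi : ∀ q : Belief Ω, Integrable (reward r δ φ fun p => envelope L p.1)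
          (Measure.dirac q) := fun q => integrable_dirac' hsm.stronglyMeasurable (by simp)
      rw [hk, integral_add_measure ((hi _).smul_measure ENNReal.ofReal_ne_top)
        ((hi _).smul_measure ENNReal.ofReal_ne_top), integral_smul_measure, integral_smul_measure,
        integral_dirac' _ _ hsm.stronglyMeasurable, integral_dirac' _ _ hsm.stronglyMeasurable,
        ENNReal.toReal_ofReal h4, ENNReal.toReal_ofReal h5, hrI qI h3, h2, smul_eq_mul,
        smul_eq_mul]
      rw [sum_smul_belief, linDrift_smul, linDrift_smul, envelope_smul _ _ h4,
        envelope_smul _ _ h5] at h1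
      have h6 := mul_le_mul_of_nonneg_left (hrJ' qJ) h5
      linarith

end LinearDrift

/-! ### The problem in which only the expected payoff matters -/

section ReducedEnvelope

variable {Ω : Type*} [Fintype Ω]

/-- The linear functional on `ℝ^Ω` that a pair defines through the mass and the payoff. -/
def pairFunctional (r : Ω → ℝ) (b : ℝ × ℝ) : Ω → ℝ := fun ω => b.1 + b.2 * r ω

theorem dotProduct_pairFunctional (r : Ω → ℝ) (b : ℝ × ℝ) (x : Ω → ℝ) :
    x ⬝ᵥ pairFunctional r b = b.1 * ∑ ω, x ω + b.2 * (x ⬝ᵥ r) := by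
  simp only [dotProduct, pairFunctional, Finset.mul_sum, ← Finset.sum_add_distrib]
  exact Finset.sum_congr rfl fun ω _ => by ring

theorem linDrift_dotProduct_pairFunctional {lam : ℝ} {m : Belief Ω} (r : Ω → ℝ) (b : ℝ × ℝ)
    (x : Ω → ℝ) : linDrift lam m x ⬝ᵥ pairFunctional r b =
      b.1 * ∑ ω, x ω + b.2 * (lam * (x ⬝ᵥ r) + (1 - lam) * (m.1 ⬝ᵥ r) * ∑ ω, x ω) := by
  rw [dotProduct_pairFunctional, sum_linDrift, linDrift_dotProduct]
  ring

variable {r : Ω → ℝ} {δ lam γ v s : ℝ} {m : Belief Ω} {F : Set (ℝ × ℝ)}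

theorem neg_mul_sum_le_dotProduct (hr : ∀ ω, -γ ≤ r ω) {x : Ω → ℝ} (hx : 0 ≤ x) :
    -γ * ∑ ω, x ω ≤ x ⬝ᵥ r := by
  rw [Finset.mul_sum]
  refine Finset.sum_le_sum fun ω _ => ?_
  rw [mul_comm]
  exact mul_le_mul_of_nonneg_left (hr ω) (hx ω)

namespace IsReducedFamily

variable (h : IsReducedFamily δ lam (m.1 ⬝ᵥ r) γ v s F)
include h

theorem base_mem_image : pairFunctional r (v, s) ∈ pairFunctional r '' F :=
  ⟨_, h.base_mem, rfl⟩

theorem nonempty_image : (pairFunctional r '' F).Nonempty := ⟨_, h.base_mem_image⟩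

theorem pairFunctional_nonneg (hγ : 0 ≤ γ) (hr : ∀ ω, -γ ≤ r ω) :
    ∀ ℓ ∈ pairFunctional r '' F, 0 ≤ ℓ := by
  rintro _ ⟨b, hb, rfl⟩ ω
  have h1 := h.const_le b hb
  obtain ⟨h2, h3⟩ := h.slope_mem b hb
  have h4 := h.base_nonneg
  have h5 := mul_le_mul_of_nonneg_left (hr ω) h2
  have h6 := mul_le_mul_of_nonneg_right h3 hγ
  change 0 ≤ b.1 + b.2 * r ω
  linarith

theorem base_le {b : ℝ × ℝ} (hb : b ∈ F) {x : Ω → ℝ} (hx : 0 ≤ x) (hxr : x ⬝ᵥ r ≤ 0) :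
    x ⬝ᵥ pairFunctional r (v, s) ≤ x ⬝ᵥ pairFunctional r b := by
  rw [dotProduct_pairFunctional, dotProduct_pairFunctional]
  exact add_le_add (mul_le_mul_of_nonneg_right (h.const_le b hb)
    (Finset.sum_nonneg fun ω _ => hx ω))
    (mul_le_mul_of_nonpos_right (h.slope_mem b hb).2 hxr)

theorem base_le_envelope {x : Ω → ℝ} (hx : 0 ≤ x) (hxr : x ⬝ᵥ r ≤ 0) :
    x ⬝ᵥ pairFunctional r (v, s) ≤ envelope (pairFunctional r '' F) x := by
  refine le_envelope h.nonempty_image ?_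
  rintro _ ⟨b, hb, rfl⟩
  exact h.base_le hb hx hxr

theorem const_le_envelope {x : Ω → ℝ} (hx : 0 ≤ x) (hxr : x ⬝ᵥ r = 0) :
    v * ∑ ω, x ω ≤ envelope (pairFunctional r '' F) x := by
  have := h.base_le_envelope hx hxr.le
  rwa [dotProduct_pairFunctional, hxr, mul_zero, add_zero] at this

theorem base_le_of_eq {x : Ω → ℝ} (hx : 0 ≤ x) (hxr : x ⬝ᵥ r = -γ * ∑ ω, x ω) (hδ0 : 0 ≤ δ) :
    x ⬝ᵥ pairFunctional r (v, s) ≤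
      δ * envelope (pairFunctional r '' F) (linDrift lam m x) := by
  rw [← envelope_smul _ _ hδ0]
  refine le_envelope h.nonempty_image ?_
  rintro _ ⟨b, hb, rfl⟩
  rw [smul_dotProduct, linDrift_dotProduct_pairFunctional, dotProduct_pairFunctional, hxr,
    smul_eq_mul]
  have h0 : 0 ≤ ∑ ω, x ω := Finset.sum_nonneg fun ω _ => hx ω
  have h1 := mul_le_mul_of_nonneg_right (h.le_wait b hb) h0
  linarith

theorem envelope_le_invest (hδ0 : 0 ≤ δ) (hγ : 0 ≤ γ) (hr : ∀ ω, -γ ≤ r ω) {x : Ω → ℝ}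
    (hx : 0 ≤ x) (hxr : 0 ≤ x ⬝ᵥ r) : envelope (pairFunctional r '' F) x ≤
      (1 - δ) * ∑ ω, x ω + δ * envelope (pairFunctional r '' F) (linDrift lam m x) := by
  rw [← envelope_smul _ _ hδ0, ← sub_le_iff_le_add']
  refine le_envelope h.nonempty_image ?_
  rintro _ ⟨b, hb, rfl⟩
  obtain ⟨b', hb', hle⟩ := h.le_invest b hb
  have h1 := hle (∑ ω, x ω) (x ⬝ᵥ r) (Finset.sum_nonneg fun ω _ => hx ω) hxr
  have h2 := envelope_le (h.pairFunctional_nonneg hγ hr) hx (Set.mem_image_of_mem _ hb')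
  rw [dotProduct_pairFunctional] at h2
  rw [smul_dotProduct, linDrift_dotProduct_pairFunctional, smul_eq_mul]
  linarith

variable (hδ0 : 0 ≤ δ) (hl0 : 0 ≤ lam) (hl1 : lam < 1) (hγ : 0 ≤ γ) (hr : ∀ ω, -γ ≤ r ω)
include hδ0 hl0 hl1 hγ hr

theorem invest_le_envelope {x : Ω → ℝ} (hx : 0 ≤ x) (hxr : 0 ≤ x ⬝ᵥ r) :
    (1 - δ) * ∑ ω, x ω + δ * envelope (pairFunctional r '' F) (linDrift lam m x) ≤
      envelope (pairFunctional r '' F) x := by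
  refine le_envelope h.nonempty_image ?_
  rintro _ ⟨b, hb, rfl⟩
  obtain ⟨b', hb', hle⟩ := h.invest_le b hb
  have h1 := hle (∑ ω, x ω) (x ⬝ᵥ r) (Finset.sum_nonneg fun ω _ => hx ω) hxr
  have h2 := mul_le_mul_of_nonneg_left (envelope_le (h.pairFunctional_nonneg hγ hr)
    (linDrift_nonneg (m := m) hl0 hl1 hx) (Set.mem_image_of_mem _ hb')) hδ0
  rw [linDrift_dotProduct_pairFunctional] at h2
  rw [dotProduct_pairFunctional]
  linarith

theorem wait_le_base {x : Ω → ℝ} (hx : 0 ≤ x) :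
    δ * envelope (pairFunctional r '' F) (linDrift lam m x) ≤
      x ⬝ᵥ pairFunctional r (v, s) := by
  obtain ⟨b, hb, hle⟩ := h.wait_le
  have h1 := hle (∑ ω, x ω) (x ⬝ᵥ r) (Finset.sum_nonneg fun ω _ => hx ω)
    (neg_mul_sum_le_dotProduct hr hx)
  have h2 := mul_le_mul_of_nonneg_left (envelope_le (h.pairFunctional_nonneg hγ hr)
    (linDrift_nonneg (m := m) hl0 hl1 hx) (Set.mem_image_of_mem _ hb)) hδ0
  rw [linDrift_dotProduct_pairFunctional] at h2
  rw [dotProduct_pairFunctional]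
  linarith

/-- When all negative payoffs are equal, only the expected payoff of a belief matters, and greedy
strategies attain the envelope of the reduced family. -/
theorem isOptimal (hδ1 : δ < 1) [DecidableEq Ω] (hneg : ∀ ω, r ω < 0 → r ω = -γ)
    {φ : Belief Ω → Belief Ω} (hφ : Measurable φ) (hlin : ∀ p, (φ p).1 = linDrift lam m p.1)
    (σ : StationaryStrategy Ω) (hσ : σ.IsGreedy r) (p₁ : Belief Ω) :
    (σ.toStrategy hφ p₁).IsOptimal r δ := by
  have hL := h.pairFunctional_nonneg hγ hr
  refine isOptimal_of_isGreedy hδ0 hδ1 hφ hlin hL h.nonempty_image (fun ℓ hℓ x hx hxr => ?_)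
    (fun ℓ hℓ x hx hxr => ?_) (fun x hx hxr => h.envelope_le_invest hδ0 hγ hr hx hxr)
    (fun p hp aI aJ qI qJ hg => ?_) σ hσ p₁
  · exact (h.invest_le_envelope hδ0 hl0 hl1 hγ hr hx hxr).trans (envelope_le hL hx hℓ)
  · obtain ⟨b, hb, rfl⟩ := hℓ
    exact (h.wait_le_base hδ0 hl0 hl1 hγ hr hx).trans (h.base_le hb hx hxr)
  · have hf := hg.1.invested_nonneg
    have hq := hg.1.rest_nonneg
    have hfr := hg.invested_payoff_eq_zero hp
    have hqr : (aJ • qJ.1) ⬝ᵥ r = -γ * ∑ ω, (aJ • qJ.1) ω := by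
      rw [Finset.mul_sum]
      refine Finset.sum_congr rfl fun ω _ => ?_
      rcases le_or_gt 0 (r ω) with h0 | h0
      · rw [hg.rest_eq_zero_of_nonneg h0]; ring
      · rw [hneg ω h0]; ring
    have h1 := envelope_le hL (add_nonneg hf hq) h.base_mem_image
    have h2 := h.base_le_envelope hf hfr.le
    have h3 := h.envelope_le_invest hδ0 hγ hr hf hfr.ge
    have h4 := h.base_le_of_eq hq hqr hδ0
    rw [add_dotProduct] at h1
    linarith

end IsReducedFamily

end ReducedEnvelope

/-! ### Two negative states with different payoffs -/

section WaitFamily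

variable {Ω : Type*} [Fintype Ω] [DecidableEq Ω]

/-- The functional that agrees with `δ * ℓ` after the drift on the mass of the states other
than `A`, and takes the value `v` at the belief of zero payoff on the edge `[A, B]`. -/
noncomputable def waitFunctional (r : Ω → ℝ) (δ lam v : ℝ) (m : Belief Ω) (A B : Ω) (ℓ : Ω → ℝ) :
    Ω → ℝ :=
  Function.update (fun ω => δ * (lam * ℓ ω + (1 - lam) * (m.1 ⬝ᵥ ℓ))) A
    ((v * (r A - r B) - r A * (δ * (lam * ℓ B + (1 - lam) * (m.1 ⬝ᵥ ℓ)))) / -r B)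

/-- Membership in the family of functionals whose envelope is the value when there are two negative
states `B` and `C`, of which `C` is the worse.  A waiting step is only performed when the result
does not exceed `pairFunctional r (v, s)` at `B`: otherwise the result need not be an upper bound
of the value on the side of `A`, and it exceeds `pairFunctional r (v, s)` on the other side, where
it is not needed. -/
inductive MemWaitFamily (r : Ω → ℝ) (δ lam v s : ℝ) (m : Belief Ω) (F : Set (ℝ × ℝ)) (A B : Ω) :
    (Ω → ℝ) → Prop
  | pair (b : ℝ × ℝ) (hb : b ∈ F) : MemWaitFamily r δ lam v s m F A B (pairFunctional r b)
  | wait (ℓ : Ω → ℝ) (hℓ : MemWaitFamily r δ lam v s m F A B ℓ)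
      (hB : waitFunctional r δ lam v m A B ℓ B ≤ pairFunctional r (v, s) B) :
      MemWaitFamily r δ lam v s m F A B (waitFunctional r δ lam v m A B ℓ)

/-- The family of functionals described by `MemWaitFamily`. -/
def waitFamily (r : Ω → ℝ) (δ lam v s : ℝ) (m : Belief Ω) (F : Set (ℝ × ℝ)) (A B : Ω) :
    Set (Ω → ℝ) :=
  {ℓ | MemWaitFamily r δ lam v s m F A B ℓ}

variable {r : Ω → ℝ} {δ lam v s : ℝ} {m : Belief Ω} {F : Set (ℝ × ℝ)} {A B C : Ω} {ℓ : Ω → ℝ}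

theorem waitFunctional_of_ne {ω : Ω} (hω : ω ≠ A) : waitFunctional r δ lam v m A B ℓ ω =
    δ * (lam * ℓ ω + (1 - lam) * (m.1 ⬝ᵥ ℓ)) :=
  Function.update_of_ne hω _ _

/-- On vectors without mass at `A`, the functional is the discounted value after the drift. -/
theorem dotProduct_waitFunctional {q : Ω → ℝ} (hq : q A = 0) :
    q ⬝ᵥ waitFunctional r δ lam v m A B ℓ = δ * (linDrift lam m q ⬝ᵥ ℓ) := by
  have h1 : q ⬝ᵥ waitFunctional r δ lam v m A B ℓ =
      ∑ ω, q ω * (δ * (lam * ℓ ω + (1 - lam) * (m.1 ⬝ᵥ ℓ))) :=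
    Finset.sum_congr rfl fun ω _ => by
      rcases eq_or_ne ω A with rfl | hω
      · rw [hq, zero_mul, zero_mul]
      · rw [waitFunctional_of_ne hω]
  rw [h1, linDrift_dotProduct]
  generalize m.1 ⬝ᵥ ℓ = M
  rw [dotProduct, Finset.mul_sum, Finset.mul_sum, Finset.sum_mul,
    ← Finset.sum_add_distrib, Finset.mul_sum]
  exact Finset.sum_congr rfl fun ω _ => by ring

theorem waitFamily_nonempty (h : IsReducedFamily δ lam (m.1 ⬝ᵥ r) (-r C) v s F) :
    (waitFamily r δ lam v s m F A B).Nonempty :=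
  ⟨_, MemWaitFamily.pair _ h.base_mem⟩

end WaitFamily

/-- Three states `A`, `B`, `C`, of which `B` and `C` are negative and `C` is the worst. The
invariant distribution `m` is on the same side as `A` of the line through `C` and the belief of zero
payoff on the edge `[A, B]`. -/
structure IsTwoNegative {Ω : Type*} [Fintype Ω] [DecidableEq Ω] (r : Ω → ℝ) (m : Belief Ω)
    (A B C : Ω) : Prop where
  univ_eq : Finset.univ = {A, B, C}
  ne_AB : A ≠ B
  ne_AC : A ≠ C
  ne_BC : B ≠ C
  nonneg_A : 0 ≤ r A
  neg_B : r B < 0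
  C_lt_B : r C < r B
  center : 0 ≤ m.1 A * r A + m.1 B * r B

namespace IsTwoNegative

variable {Ω : Type*} [Fintype Ω] [DecidableEq Ω]
variable {r : Ω → ℝ} {δ lam v s : ℝ} {m : Belief Ω} {F : Set (ℝ × ℝ)} {A B C : Ω}
variable (T : IsTwoNegative r m A B C)
include T

theorem sum_eq (x : Ω → ℝ) : ∑ ω, x ω = x A + x B + x C := by
  rw [T.univ_eq, Finset.sum_insert (by simp [T.ne_AB, T.ne_AC]), Finset.sum_pair T.ne_BC, add_assoc]

theorem dot_eq (x ℓ : Ω → ℝ) : x ⬝ᵥ ℓ = x A * ℓ A + x B * ℓ B + x C * ℓ C := T.sum_eq _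

theorem eq_or (ω : Ω) : ω = A ∨ ω = B ∨ ω = C := by
  simpa [T.univ_eq] using Finset.mem_univ ω

theorem neg_C : r C < 0 := T.C_lt_B.trans T.neg_B

theorem C_le (ω : Ω) : -(-r C) ≤ r ω := by
  rw [neg_neg]
  rcases T.eq_or ω with rfl | rfl | rfl
  exacts [T.neg_C.le.trans T.nonneg_A, T.C_lt_B.le, le_rfl]

/-- The region on the same side as `A` is invariant under the drift. -/
theorem linDrift_side (hl0 : 0 ≤ lam) (hl1 : lam < 1) {x : Ω → ℝ} (hx : 0 ≤ x)
    (hk : 0 ≤ x A * r A + x B * r B) :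
    0 ≤ linDrift lam m x A * r A + linDrift lam m x B * r B := by
  simp only [linDrift, Pi.add_apply, Pi.smul_apply, smul_eq_mul]
  have h1 := mul_nonneg hl0 hk
  have h0 : 0 ≤ ∑ ω, x ω := Finset.sum_nonneg fun ω _ => hx ω
  have h2 := mul_nonneg (mul_nonneg (sub_nonneg.2 hl1.le) h0) T.center
  linarith

theorem side_of_invest {x : Ω → ℝ} (hx : 0 ≤ x) (hxr : 0 ≤ x ⬝ᵥ r) :
    0 ≤ x A * r A + x B * r B := by
  rw [T.dot_eq] at hxr
  have := mul_nonpos_of_nonneg_of_nonpos (hx C) T.neg_C.le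
  linarith

/-- A signed decomposition: the mass of `A` is matched with mass of `B` to yield zero payoff. -/
theorem exists_decomposition (x : Ω → ℝ) : ∃ f q : Ω → ℝ, x = f + q ∧ f ⬝ᵥ r = 0 ∧ f A = x A ∧
    f B * -r B = x A * r A ∧ f C = 0 ∧ q A = 0 ∧ q B * -r B = -(x A * r A + x B * r B) ∧
      q C = x C := by
  have hB : 0 < -r B := neg_pos.2 T.neg_B
  have e : x A * r A / -r B * -r B = x A * r A := div_mul_cancel₀ _ hB.ne'
  obtain ⟨f, hf⟩ : ∃ f : Ω → ℝ, f = Pi.single A (x A) + Pi.single B (x A * r A / -r B) :=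
    ⟨_, rfl⟩
  have hfA : f A = x A := by simp [hf, T.ne_AB]
  have hfB : f B = x A * r A / -r B := by simp [hf, T.ne_AB.symm]
  have hfC : f C = 0 := by simp [hf, T.ne_AC.symm, T.ne_BC.symm]
  refine ⟨f, x - f, by abel, ?_, hfA, ?_, hfC, ?_, ?_, ?_⟩
  · rw [T.dot_eq, hfA, hfB, hfC]; linarith
  · rw [hfB, e]
  · simp [hfA]
  · rw [Pi.sub_apply, hfB, sub_mul, e]; ring
  · simp [hfC]

/-- A waiting step takes the value `v` at beliefs of zero payoff on the edge `[A, B]`. -/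
theorem dot_waitFunctional_of_frontier {f ℓ : Ω → ℝ} (hfr : f ⬝ᵥ r = 0) (hfC : f C = 0) :
    f ⬝ᵥ waitFunctional r δ lam v m A B ℓ = v * ∑ ω, f ω := by
  have hB : 0 < -r B := neg_pos.2 T.neg_B
  rw [T.dot_eq, hfC] at hfr ⊢
  rw [T.sum_eq, hfC, waitFunctional_of_ne T.ne_AB.symm, waitFunctional, Function.update_self]
  set w := δ * (lam * ℓ B + (1 - lam) * (m.1 ⬝ᵥ ℓ)) with hw
  have e : (v * (r A - r B) - r A * w) / -r B * -r B = v * (r A - r B) - r A * w :=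
    div_mul_cancel₀ _ hB.ne'
  refine mul_right_cancel₀ hB.ne' ?_
  have e2 : f A * r A = -(f B * r B) := by linarith
  linear_combination f A * e + (v - w) * e2

/-- At the worst state `C`, a waiting step from an upper bound of the envelope of the reduced
family is at least the functional `(v, s)`. -/
theorem pair_le_wait_C (h : IsReducedFamily δ lam (m.1 ⬝ᵥ r) (-r C) v s F) (hδ0 : 0 ≤ δ)
    {ℓ : Ω → ℝ}
    (hℓ : envelope (pairFunctional r '' F) (linDrift lam m (Pi.single C 1)) ≤
      linDrift lam m (Pi.single C 1) ⬝ᵥ ℓ) :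
    pairFunctional r (v, s) C ≤ waitFunctional r δ lam v m A B ℓ C := by
  have h0 : (0 : Ω → ℝ) ≤ Pi.single C 1 := Pi.single_nonneg.2 zero_le_one
  have h1 := h.base_le_of_eq h0 (by simp) hδ0
  have h2 := dotProduct_waitFunctional (r := r) (δ := δ) (lam := lam) (v := v) (m := m) (A := A)
    (B := B) (ℓ := ℓ) (q := Pi.single C 1) (Pi.single_eq_of_ne T.ne_AC 1)
  rw [single_dotProduct, one_mul] at h1 h2
  rw [h2]
  exact h1.trans (mul_le_mul_of_nonneg_left hℓ hδ0)

theorem single_C_side (hl0 : 0 ≤ lam) (hl1 : lam < 1) :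
    0 ≤ linDrift lam m (Pi.single C 1) A * r A + linDrift lam m (Pi.single C 1) B * r B :=
  T.linDrift_side hl0 hl1 (Pi.single_nonneg.2 zero_le_one) (by simp [T.ne_AC, T.ne_BC])

theorem dotProduct_nonpos_of_A_eq_zero {q : Ω → ℝ} (hq : 0 ≤ q) (hqA : q A = 0) :
    q ⬝ᵥ r ≤ 0 := by
  rw [T.dot_eq, hqA]
  have h1 := mul_nonpos_of_nonneg_of_nonpos (hq B) T.neg_B.le
  have h2 := mul_nonpos_of_nonneg_of_nonpos (hq C) T.neg_C.le
  linarith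

variable (h : IsReducedFamily δ lam (m.1 ⬝ᵥ r) (-r C) v s F)
variable (hδ0 : 0 ≤ δ) (hl0 : 0 ≤ lam) (hl1 : lam < 1)
include h hδ0 hl0 hl1

/-- On the side of `A`, every member of the family is an upper bound of the value of the reduced
problem. -/
theorem reduced_le {ℓ : Ω → ℝ} (hℓ : ℓ ∈ waitFamily r δ lam v s m F A B) {x : Ω → ℝ} (hx : 0 ≤ x)
    (hk : 0 ≤ x A * r A + x B * r B) : envelope (pairFunctional r '' F) x ≤ x ⬝ᵥ ℓ := by
  have hP := h.pairFunctional_nonneg (neg_pos.2 T.neg_C).le T.C_le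
  induction hℓ generalizing x with
  | pair b hb => exact envelope_le hP hx (Set.mem_image_of_mem _ hb)
  | wait ℓ hℓ hB ih =>
    have hC := T.pair_le_wait_C h hδ0 (ih (linDrift_nonneg hl0 hl1
      (Pi.single_nonneg.2 zero_le_one)) (T.single_C_side hl0 hl1))
    refine (envelope_le hP hx h.base_mem_image).trans ?_
    obtain ⟨f, q, rfl, hfr, hfA, hfB, hfC, hqA, hqB, hqC⟩ := T.exists_decomposition x
    rw [add_dotProduct, add_dotProduct, T.dot_waitFunctional_of_frontier hfr hfC,
      dotProduct_pairFunctional _ _ f, hfr, mul_zero, add_zero, T.dot_eq q, T.dot_eq q, hqA]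
    -- the coefficient of `B` in the remaining part is nonpositive on the side of `A`
    have hq0 : q B ≤ 0 := by
      by_contra hcon
      have := mul_pos (not_le.1 hcon) (neg_pos.2 T.neg_B)
      linarith
    have h1 := mul_le_mul_of_nonpos_left hB hq0
    have h2 := mul_le_mul_of_nonneg_left hC (hqC ▸ hx C : 0 ≤ q C)
    linarith

theorem waitFamily_apply_A_nonneg {ℓ : Ω → ℝ} (hℓ : ℓ ∈ waitFamily r δ lam v s m F A B) :
    0 ≤ ℓ A := by
  have h0 : (0 : Ω → ℝ) ≤ Pi.single A 1 := Pi.single_nonneg.2 zero_le_one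
  have h1 := T.reduced_le h hδ0 hl0 hl1 hℓ h0 (by simp [T.ne_AB.symm, T.nonneg_A])
  rw [single_dotProduct, one_mul] at h1
  exact (envelope_nonneg (h.pairFunctional_nonneg (neg_pos.2 T.neg_C).le T.C_le) h0).trans h1

theorem waitFamily_nonneg {ℓ : Ω → ℝ} (hℓ : ℓ ∈ waitFamily r δ lam v s m F A B) : 0 ≤ ℓ := by
  have hA := T.waitFamily_apply_A_nonneg h hδ0 hl0 hl1 hℓ
  induction hℓ with
  | pair b hb =>
    exact h.pairFunctional_nonneg (neg_pos.2 T.neg_C).le T.C_le _ (Set.mem_image_of_mem _ hb)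
  | wait ℓ hℓ hB ih =>
    have hℓ0 : 0 ≤ ℓ := ih (T.waitFamily_apply_A_nonneg h hδ0 hl0 hl1 hℓ)
    have hm : 0 ≤ m.1 ⬝ᵥ ℓ := dotProduct_nonneg_of_nonneg m.2.1 hℓ0
    intro ω
    by_cases hω : ω = A
    · rw [hω]; exact hA
    · rw [waitFunctional_of_ne hω]
      exact mul_nonneg hδ0 (add_nonneg (mul_nonneg hl0 (hℓ0 ω))
        (mul_nonneg (sub_nonneg.2 hl1.le) hm))

theorem envelope_le_reduced {x : Ω → ℝ} (hx : 0 ≤ x) :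
    envelope (waitFamily r δ lam v s m F A B) x ≤ envelope (pairFunctional r '' F) x := by
  refine le_envelope h.nonempty_image ?_
  rintro _ ⟨b, hb, rfl⟩
  exact envelope_le (fun _ hℓ => T.waitFamily_nonneg h hδ0 hl0 hl1 hℓ) hx (MemWaitFamily.pair b hb)

/-- On the side of `A`, the value is that of the reduced problem. -/
theorem reduced_le_envelope {x : Ω → ℝ} (hx : 0 ≤ x) (hk : 0 ≤ x A * r A + x B * r B) :
    envelope (pairFunctional r '' F) x ≤ envelope (waitFamily r δ lam v s m F A B) x :=
  le_envelope (waitFamily_nonempty h) fun _ hℓ => T.reduced_le h hδ0 hl0 hl1 hℓ hx hk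

/-- On the edge `[B, C]`, waiting is dominated by the envelope. -/
theorem wait_le_envelope {q : Ω → ℝ} (hq : 0 ≤ q) (hqA : q A = 0) :
    δ * envelope (waitFamily r δ lam v s m F A B) (linDrift lam m q) ≤
      envelope (waitFamily r δ lam v s m F A B) q := by
  have hΦ : 0 ≤ linDrift lam m q := linDrift_nonneg hl0 hl1 hq
  refine le_envelope (waitFamily_nonempty h) fun ℓ hℓ => ?_
  cases hℓ with
  | pair b hb =>
    exact ((mul_le_mul_of_nonneg_left (T.envelope_le_reduced h hδ0 hl0 hl1 hΦ) hδ0).trans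
      (h.wait_le_base hδ0 hl0 hl1 (neg_pos.2 T.neg_C).le T.C_le hq)).trans
      (h.base_le hb hq (T.dotProduct_nonpos_of_A_eq_zero hq hqA))
  | wait ℓ hℓ hB =>
    rw [dotProduct_waitFunctional hqA]
    exact mul_le_mul_of_nonneg_left
      (envelope_le (fun _ hℓ => T.waitFamily_nonneg h hδ0 hl0 hl1 hℓ) hΦ hℓ) hδ0

/-- Investing the mass of a frontier vector is at least as good as waiting with it. -/
theorem wait_le_const {f : Ω → ℝ} (hδ1 : δ < 1) (hf : 0 ≤ f) (hfr : f ⬝ᵥ r = 0) :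
    δ * envelope (waitFamily r δ lam v s m F A B) (linDrift lam m f) ≤ v * ∑ ω, f ω := by
  have hγ := (neg_pos.2 T.neg_C).le
  have h1 := h.invest_le_envelope hδ0 hl0 hl1 hγ T.C_le hf hfr.ge
  have h2 := envelope_le (h.pairFunctional_nonneg hγ T.C_le) hf h.base_mem_image
  have h3 := mul_le_mul_of_nonneg_left
    (T.envelope_le_reduced h hδ0 hl0 hl1 (linDrift_nonneg (m := m) hl0 hl1 hf)) hδ0
  have h4 : 0 ≤ ∑ ω, f ω := Finset.sum_nonneg fun ω _ => hf ω
  have h5 := mul_nonneg (sub_nonneg.2 hδ1.le) h4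
  rw [dotProduct_pairFunctional, hfr, mul_zero, add_zero] at h2
  linarith

/-- Adding frontier mass on the edge `[A, B]` to `z` raises the value by at most `v` times this
mass, where `z` is a mixture of `m` with a vector without mass at `A`. -/
theorem envelope_add_frontier_le {f q : Ω → ℝ} {a b : ℝ} (ha : 0 ≤ a) (hb : 0 ≤ b) (hf : 0 ≤ f)
    (hfr : f ⬝ᵥ r = 0) (hfC : f C = 0) (hq : 0 ≤ q) (hqA : q A = 0) :
    envelope (waitFamily r δ lam v s m F A B) (a • q + b • m.1 + f) ≤
      envelope (waitFamily r δ lam v s m F A B) (a • q + b • m.1) + v * ∑ ω, f ω := by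
  have hz : 0 ≤ a • q + b • m.1 := add_nonneg (smul_nonneg ha hq) (smul_nonneg hb m.2.1)
  have hL : ∀ ℓ ∈ waitFamily r δ lam v s m F A B, 0 ≤ ℓ :=
    fun _ hℓ => T.waitFamily_nonneg h hδ0 hl0 hl1 hℓ
  rw [← sub_le_iff_le_add]
  refine le_envelope (waitFamily_nonempty h) fun ℓ hℓ => ?_
  rw [sub_le_iff_le_add]
  have hle : ∀ ℓ' ∈ waitFamily r δ lam v s m F A B, f ⬝ᵥ ℓ' = v * ∑ ω, f ω →
      envelope (waitFamily r δ lam v s m F A B) (a • q + b • m.1 + f) ≤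
        (a • q + b • m.1) ⬝ᵥ ℓ' + v * ∑ ω, f ω := fun ℓ' hℓ' e => by
    rw [← e, ← add_dotProduct]
    exact envelope_le hL (add_nonneg hz hf) hℓ'
  cases hℓ with
  | pair b' hb' =>
    rcases h.const_eq_or with hv | hμ
    · refine hle _ (MemWaitFamily.pair b' hb') ?_
      rw [dotProduct_pairFunctional, hfr, mul_zero, add_zero, hv b' hb']
    · -- outside the investment region, `(v, s)` is the minimal member of the reduced family
      have hzr : (a • q + b • m.1) ⬝ᵥ r ≤ 0 := by
        rw [add_dotProduct, smul_dotProduct, smul_dotProduct]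
        exact add_nonpos (mul_nonpos_of_nonneg_of_nonpos ha
          (T.dotProduct_nonpos_of_A_eq_zero hq hqA))
          (mul_nonpos_of_nonneg_of_nonpos hb hμ)
      refine (hle _ (MemWaitFamily.pair _ h.base_mem) ?_).trans
        (add_le_add (h.base_le hb' hz hzr) le_rfl)
      rw [dotProduct_pairFunctional, hfr, mul_zero, add_zero]
  | wait ℓ hℓ hB =>
    exact hle _ (MemWaitFamily.wait ℓ hℓ hB) (T.dot_waitFunctional_of_frontier hfr hfC)

/-- The key inequality: it is better to invest the frontier mass `f` at once than to wait with
it. The drift adds mass at `m` to `lam • q`; by concavity of the value along this ray, the mass at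
`m` contributed by `f` adds at most as much per unit as that contributed by `q`, which is known
from the comparison of `q` with its own drift. -/
theorem wait_le_const_add {f q : Ω → ℝ} (hδ1 : δ < 1) (hf : 0 ≤ f) (hfr : f ⬝ᵥ r = 0)
    (hfC : f C = 0) (hq : 0 ≤ q) (hqA : q A = 0) :
    δ * envelope (waitFamily r δ lam v s m F A B) (linDrift lam m (f + q)) ≤
      v * ∑ ω, f ω + envelope (waitFamily r δ lam v s m F A B) q := by
  have hL : ∀ ℓ ∈ waitFamily r δ lam v s m F A B, 0 ≤ ℓ :=
    fun _ hℓ => T.waitFamily_nonneg h hδ0 hl0 hl1 hℓ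
  set W := envelope (waitFamily r δ lam v s m F A B) with hW
  have he0 : 0 ≤ ∑ ω, f ω := Finset.sum_nonneg fun ω _ => hf ω
  have hN0 : 0 ≤ ∑ ω, q ω := Finset.sum_nonneg fun ω _ => hq ω
  rcases hN0.eq_or_lt with hN | hN
  · have hq0 : q = 0 := funext fun ω =>
      (Finset.sum_eq_zero_iff_of_nonneg fun ω _ => hq ω).1 hN.symm ω (Finset.mem_univ ω)
    have h1 := T.wait_le_const h hδ0 hl0 hl1 hδ1 hf hfr
    have h2 : 0 ≤ W q := envelope_nonneg hL hq
    rw [hq0] at h2 ⊢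
    rw [add_zero]
    linarith
  obtain ⟨e, he⟩ : ∃ e, e = ∑ ω, f ω := ⟨_, rfl⟩
  obtain ⟨N, hN'⟩ : ∃ N, N = ∑ ω, q ω := ⟨_, rfl⟩
  rw [← he] at he0 ⊢
  rw [← hN'] at hN
  have hb0 : 0 ≤ (1 - lam) * (N + e) := mul_nonneg (sub_nonneg.2 hl1.le) (by linarith)
  set z := lam • q + ((1 - lam) * (N + e)) • m.1 with hz
  have hz0 : 0 ≤ z := add_nonneg (smul_nonneg hl0 hq) (smul_nonneg hb0 m.2.1)
  have hΦ0 : 0 ≤ linDrift lam m q := linDrift_nonneg hl0 hl1 hq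
  have hsplit : linDrift lam m (f + q) = z + lam • f := by
    ext ω
    simp only [hz, linDrift, Pi.add_apply, Pi.smul_apply, smul_eq_mul, Finset.sum_add_distrib,
      ← he, ← hN']
    ring
  have h1 : W (z + lam • f) ≤ W z + v * (lam * e) := by
    have h := T.envelope_add_frontier_le h hδ0 hl0 hl1 hl0 hb0 (smul_nonneg hl0 hf)
      (by rw [smul_dotProduct, hfr, smul_zero]) (by simp [hfC]) hq hqA
    simpa only [Pi.smul_apply, smul_eq_mul, ← Finset.mul_sum, ← he] using h
  -- concavity along the ray from `lam • q` in the direction of `m`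
  have h2 : e * (lam * W q) + N * W z ≤ (N + e) * W (linDrift lam m q) := by
    rw [hW, ← envelope_smul _ (linDrift lam m q) (by linarith : 0 ≤ N + e)]
    refine le_envelope (waitFamily_nonempty h) fun ℓ hℓ => ?_
    have a1 := mul_le_mul_of_nonneg_left (mul_le_mul_of_nonneg_left (envelope_le hL hq hℓ) hl0) he0
    have a2 := mul_le_mul_of_nonneg_left (envelope_le hL hz0 hℓ) hN.le
    refine (add_le_add a1 a2).trans (le_of_eq ?_)
    rw [smul_dotProduct, linDrift_dotProduct, hz, add_dotProduct, smul_dotProduct, smul_dotProduct,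
      ← hN', smul_eq_mul, smul_eq_mul, smul_eq_mul]
    ring
  have h3 : δ * W (linDrift lam m q) ≤ W q := T.wait_le_envelope h hδ0 hl0 hl1 hq hqA
  have h4 : W q ≤ v * N := by
    have a1 := envelope_le hL hq (MemWaitFamily.pair _ h.base_mem)
    rw [dotProduct_pairFunctional, ← hN'] at a1
    have a2 := mul_nonpos_of_nonneg_of_nonpos h.slope_nonneg
      (T.dotProduct_nonpos_of_A_eq_zero hq hqA)
    exact a1.trans (by simp only; linarith)
  rw [hsplit]
  refine le_of_mul_le_mul_left ?_ hN
  have b1 := mul_le_mul_of_nonneg_left h1 (mul_nonneg hN.le hδ0)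
  have b2 := mul_le_mul_of_nonneg_left h2 hδ0
  have b3 := mul_le_mul_of_nonneg_left h3 (by linarith : 0 ≤ N + e)
  have b4 := mul_le_mul_of_nonneg_left h4
    (mul_nonneg he0 (by nlinarith : 0 ≤ 1 - δ * lam))
  linarith

/-- Outside the investment region, waiting is dominated by every member of the family. -/
theorem wait_le {ℓ : Ω → ℝ} (hδ1 : δ < 1) (hℓ : ℓ ∈ waitFamily r δ lam v s m F A B) {x : Ω → ℝ}
    (hx : 0 ≤ x) (hxr : x ⬝ᵥ r ≤ 0) :
    δ * envelope (waitFamily r δ lam v s m F A B) (linDrift lam m x) ≤ x ⬝ᵥ ℓ := by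
  have hγ := (neg_pos.2 T.neg_C).le
  rcases le_or_gt 0 (x A * r A + x B * r B) with hk | hk
  · calc δ * envelope (waitFamily r δ lam v s m F A B) (linDrift lam m x)
        ≤ δ * envelope (pairFunctional r '' F) (linDrift lam m x) :=
          mul_le_mul_of_nonneg_left
            (T.envelope_le_reduced h hδ0 hl0 hl1 (linDrift_nonneg hl0 hl1 hx)) hδ0
      _ ≤ x ⬝ᵥ pairFunctional r (v, s) := h.wait_le_base hδ0 hl0 hl1 hγ T.C_le hx
      _ ≤ envelope (pairFunctional r '' F) x := h.base_le_envelope hx hxr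
      _ ≤ x ⬝ᵥ ℓ := T.reduced_le h hδ0 hl0 hl1 hℓ hx hk
  · obtain ⟨f, q, rfl, hfr, hfA, hfB, hfC, hqA, hqB, hqC⟩ := T.exists_decomposition x
    have hB : 0 < -r B := neg_pos.2 T.neg_B
    have hfA0 : 0 ≤ f A := hfA ▸ hx A
    have hf : 0 ≤ f := by
      intro ω
      rcases T.eq_or ω with rfl | rfl | rfl
      · exact hfA0
      · refine nonneg_of_mul_nonneg_left (b := -r ω) ?_ hB
        rw [hfB]
        exact mul_nonneg (hx A) T.nonneg_A
      · exact hfC.ge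
    have hq : 0 ≤ q := by
      intro ω
      rcases T.eq_or ω with rfl | rfl | rfl
      · exact hqA.ge
      · refine nonneg_of_mul_nonneg_left (b := -r ω) ?_ hB
        rw [hqB]
        linarith
      · rw [hqC]
        exact hx _
    have h1 := T.wait_le_const_add h hδ0 hl0 hl1 hδ1 hf hfr hfC hq hqA
    have h2 := envelope_le (fun _ hℓ => T.waitFamily_nonneg h hδ0 hl0 hl1 hℓ) hq hℓ
    have h3 := h.const_le_envelope hf hfr
    have h4 := T.reduced_le h hδ0 hl0 hl1 hℓ hf (T.side_of_invest hf hfr.ge)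
    rw [add_dotProduct]
    linarith

/-- In the investment region, the envelope is attained by investing. -/
theorem envelope_le_invest {x : Ω → ℝ} (hx : 0 ≤ x) (hxr : 0 ≤ x ⬝ᵥ r) :
    envelope (waitFamily r δ lam v s m F A B) x ≤ (1 - δ) * ∑ ω, x ω +
      δ * envelope (waitFamily r δ lam v s m F A B) (linDrift lam m x) := by
  have h1 := T.envelope_le_reduced h hδ0 hl0 hl1 hx
  have h2 := h.envelope_le_invest hδ0 (neg_pos.2 T.neg_C).le T.C_le hx hxr
  have h3 := mul_le_mul_of_nonneg_left (T.reduced_le_envelope h hδ0 hl0 hl1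
    (linDrift_nonneg hl0 hl1 hx) (T.linDrift_side hl0 hl1 hx (T.side_of_invest hx hxr))) hδ0
  linarith

/-- Outside the investment region, the envelope is attained by splittings whose remaining part
is all at `C`, or whose invested part is on the edge `[A, B]`. -/
theorem envelope_add_le {f q : Ω → ℝ} (hf : 0 ≤ f) (hfr : f ⬝ᵥ r = 0) (hq : 0 ≤ q)
    (hqA : q A = 0) (hor : f C = 0 ∨ q B = 0) :
    envelope (waitFamily r δ lam v s m F A B) (f + q) ≤ v * ∑ ω, f ω +
      δ * envelope (waitFamily r δ lam v s m F A B) (linDrift lam m q) := by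
  have hL : ∀ ℓ ∈ waitFamily r δ lam v s m F A B, 0 ≤ ℓ :=
    fun _ hℓ => T.waitFamily_nonneg h hδ0 hl0 hl1 hℓ
  have hbase := envelope_le hL (add_nonneg hf hq) (MemWaitFamily.pair _ h.base_mem)
  rw [add_dotProduct, dotProduct_pairFunctional _ _ f, hfr, mul_zero, add_zero] at hbase
  rcases hor with hfC | hqB
  · rw [← sub_le_iff_le_add', ← envelope_smul _ _ hδ0]
    refine le_envelope (waitFamily_nonempty h) fun ℓ hℓ => ?_
    rw [sub_le_iff_le_add', smul_dotProduct, smul_eq_mul,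
      ← dotProduct_waitFunctional (r := r) (v := v) (B := B) hqA]
    rcases le_or_gt (waitFunctional r δ lam v m A B ℓ B) (pairFunctional r (v, s) B) with hB | hB
    · have h1 := envelope_le hL (add_nonneg hf hq) (MemWaitFamily.wait ℓ hℓ hB)
      rwa [add_dotProduct, T.dot_waitFunctional_of_frontier hfr hfC] at h1
    · refine hbase.trans (add_le_add le_rfl ?_)
      have hC := T.pair_le_wait_C h hδ0 (T.reduced_le h hδ0 hl0 hl1 hℓ (linDrift_nonneg hl0 hl1
        (Pi.single_nonneg.2 zero_le_one)) (T.single_C_side hl0 hl1))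
      rw [T.dot_eq, T.dot_eq, hqA, zero_mul, zero_mul]
      have h1 := mul_le_mul_of_nonneg_left hB.le (hq B)
      have h2 := mul_le_mul_of_nonneg_left hC (hq C)
      linarith
  · have hqr : q ⬝ᵥ r = -(-r C) * ∑ ω, q ω := by
      rw [T.dot_eq, T.sum_eq, hqA, hqB]; ring
    have h1 := h.base_le_of_eq hq hqr hδ0
    have h2 := mul_le_mul_of_nonneg_left (T.reduced_le_envelope h hδ0 hl0 hl1
      (linDrift_nonneg hl0 hl1 hq) (T.linDrift_side hl0 hl1 hq (by simp [hqA, hqB]))) hδ0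
    simp only at hbase
    linarith

/-- With two negative states, greedy strategies attain the envelope of the waiting family. -/
theorem isOptimal (hδ1 : δ < 1) {φ : Belief Ω → Belief Ω} (hφ : Measurable φ)
    (hlin : ∀ p, (φ p).1 = linDrift lam m p.1)
    (σ : StationaryStrategy Ω) (hσ : σ.IsGreedy r) (p₁ : Belief Ω) :
    (σ.toStrategy hφ p₁).IsOptimal r δ := by
  have hγ := (neg_pos.2 T.neg_C).le
  refine isOptimal_of_isGreedy hδ0 hδ1 hφ hlin
    (fun _ hℓ => T.waitFamily_nonneg h hδ0 hl0 hl1 hℓ) (waitFamily_nonempty h)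
    (fun ℓ hℓ x hx hxr => ?_) (fun ℓ hℓ x hx hxr => T.wait_le h hδ0 hl0 hl1 hδ1 hℓ hx hxr)
    (fun x hx hxr => T.envelope_le_invest h hδ0 hl0 hl1 hx hxr)
    (fun p hp aI aJ qI qJ hg => ?_) σ hσ p₁
  · have h1 := h.invest_le_envelope hδ0 hl0 hl1 hγ T.C_le hx hxr
    have h2 := T.reduced_le h hδ0 hl0 hl1 hℓ hx (T.side_of_invest hx hxr)
    have h3 := mul_le_mul_of_nonneg_left
      (T.envelope_le_reduced h hδ0 hl0 hl1 (linDrift_nonneg (m := m) hl0 hl1 hx)) hδ0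
    linarith
  · have hf := hg.1.invested_nonneg
    have hfr := hg.invested_payoff_eq_zero hp
    have h1 := T.envelope_add_le h hδ0 hl0 hl1 hf hfr hg.1.rest_nonneg
      (hg.rest_eq_zero_of_nonneg T.nonneg_A)
      (hg.invested_eq_zero_or_rest_eq_zero T.neg_B T.C_lt_B)
    have h2 := h.const_le_envelope hf hfr
    have h3 := T.reduced_le_envelope h hδ0 hl0 hl1 hf (T.side_of_invest hf hfr.ge)
    have h4 := T.envelope_le_invest h hδ0 hl0 hl1 hf hfr.ge
    linarith

end IsTwoNegative

/-! ### Labelling the states -/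

section ThreeStates

variable {Ω : Type*} [Fintype Ω] {r : Ω → ℝ} {m : Belief Ω}

theorem mem_negStates {ω : Ω} : ω ∈ negStates r ↔ r ω < 0 := by
  simp [negStates]

theorem IsHomothety.exists_linDrift {φ : Belief Ω → Belief Ω} (h : IsHomothety φ m) :
    ∃ lam : ℝ, 0 ≤ lam ∧ lam < 1 ∧ ∀ p, (φ p).1 = linDrift lam m p.1 := by
  obtain ⟨lam, h0, h1, h2⟩ := h
  refine ⟨lam, h0, h1, fun p => ?_⟩
  rw [eq_add_of_sub_eq (h2 p), linDrift, p.2.2, mul_one, sub_smul, one_smul, smul_sub]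
  abel

variable [DecidableEq Ω] {A B C : Ω}

theorem univ_eq_of_card (hΩ : Fintype.card Ω = 3) (hAB : A ≠ B) (hAC : A ≠ C) (hBC : B ≠ C) :
    Finset.univ = ({A, B, C} : Finset Ω) := by
  symm
  rw [← Finset.card_eq_iff_eq_univ, hΩ, Finset.card_eq_three]
  exact ⟨A, B, C, hAB, hAC, hBC, rfl⟩

/-- A third state. -/
theorem exists_third (hΩ : Fintype.card Ω = 3) (B C : Ω) : ∃ A, A ≠ B ∧ A ≠ C := by
  by_contra! hcon
  have h1 : (Finset.univ : Finset Ω) ⊆ {B, C} := fun ω _ => by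
    rw [Finset.mem_insert, Finset.mem_singleton]
    by_cases h : ω = B
    · exact Or.inl h
    · exact Or.inr (hcon ω h)
  have h2 := (Finset.card_le_card h1).trans Finset.card_le_two
  rw [Finset.card_univ, hΩ] at h2
  omega

/-- The triangle lies on the side of `A` of the line through `C` and `Bplus`. -/
theorem center_nonneg_of_mem_triangle {Bplus Cplus : Belief Ω} (hA : 0 ≤ r A) (hAB : A ≠ B)
    (hAC : A ≠ C) (hBC : B ≠ C) (hΩ : Fintype.card Ω = 3)
    (hB : Bplus ∈ investFrontier r) (hB' : Bplus.1 ∈ segment ℝ (vertex A) (vertex B))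
    (hC' : Cplus.1 ∈ segment ℝ (vertex A) (vertex C))
    (hm : m.1 ∈ convexHull ℝ {Cplus.1, Bplus.1, vertex C}) :
    0 ≤ m.1 A * r A + m.1 B * r B := by
  have hconv : Convex ℝ {x : Ω → ℝ | 0 ≤ x A * r A + x B * r B} := by
    intro x hx y hy a b ha hb _
    have h1 := mul_nonneg ha hx
    have h2 := mul_nonneg hb hy
    change 0 ≤ (a * x A + b * y A) * r A + (a * x B + b * y B) * r B
    linarith
  refine convexHull_min (s := {Cplus.1, Bplus.1, vertex C}) ?_ hconv hm
  rintro x (rfl | rfl | rfl)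
  · obtain ⟨a, b, -, -, -, e⟩ := hC'
    have hB0 : Cplus.1 B = 0 := by simp [← e, hAB.symm, hBC]
    change 0 ≤ Cplus.1 A * r A + Cplus.1 B * r B
    rw [hB0, zero_mul, add_zero]
    exact mul_nonneg (Cplus.2.1 A) hA
  · obtain ⟨a, b, -, -, -, e⟩ := hB'
    have hC0 : Bplus.1 C = 0 := by simp [← e, hAC.symm, hBC.symm]
    have h1 : ∑ ω, Bplus.1 ω * r ω = 0 := hB
    rw [univ_eq_of_card hΩ hAB hAC hBC, Finset.sum_insert (by simp [hAB, hAC]),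
      Finset.sum_pair hBC, hC0] at h1
    change 0 ≤ Bplus.1 A * r A + Bplus.1 B * r B
    linarith
  · change 0 ≤ vertex C A * r A + vertex C B * r B
    simp [hAC, hBC]

variable {δ lam : ℝ} {φ : Belief Ω → Belief Ω}

/-- Optimality when all negative payoffs are equal, to the payoff of `C`. -/
theorem isOptimal_of_forall_neg_eq (hδ0 : 0 ≤ δ) (hδ1 : δ < 1) (hl0 : 0 ≤ lam) (hl1 : lam < 1)
    (hφ : Measurable φ) (hlin : ∀ p, (φ p).1 = linDrift lam m p.1) (hC : r C < 0)
    (hneg : ∀ ω, r ω < 0 → r ω = r C) (σ : StationaryStrategy Ω) (hσ : σ.IsGreedy r)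
    (p₁ : Belief Ω) : (σ.toStrategy hφ p₁).IsOptimal r δ := by
  have hr : ∀ ω, -(-r C) ≤ r ω := fun ω => by
    rw [neg_neg]
    rcases le_or_gt 0 (r ω) with h | h
    · exact hC.le.trans h
    · exact (hneg ω h).ge
  have hμ := neg_mul_sum_le_dotProduct hr m.2.1
  rw [m.2.2, mul_one] at hμ
  obtain ⟨v, s, F, h⟩ := exists_isReducedFamily hδ0 hδ1 hl0 hl1 (neg_pos.2 hC) hμ
  exact h.isOptimal hδ0 hl0 hl1 (neg_pos.2 hC).le hr hδ1
    (fun ω hω => (hneg ω hω).trans (neg_neg _).symm) hφ hlin σ hσ p₁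

/-- Optimality when `B` and `C` are the negative states, and `m` is on the side of `A`. -/
theorem isOptimal_of_two_neg (hΩ : Fintype.card Ω = 3) (hδ0 : 0 ≤ δ) (hδ1 : δ < 1) (hl0 : 0 ≤ lam)
    (hl1 : lam < 1) (hφ : Measurable φ) (hlin : ∀ p, (φ p).1 = linDrift lam m p.1)
    (hAB : A ≠ B) (hAC : A ≠ C) (hBC : B ≠ C) (hA : 0 ≤ r A) (hB : r B < 0) (hCB : r C ≤ r B)
    (hm : 0 ≤ m.1 A * r A + m.1 B * r B) (σ : StationaryStrategy Ω) (hσ : σ.IsGreedy r)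
    (p₁ : Belief Ω) : (σ.toStrategy hφ p₁).IsOptimal r δ := by
  have huniv := univ_eq_of_card hΩ hAB hAC hBC
  rcases hCB.eq_or_lt with heq | hlt
  · refine isOptimal_of_forall_neg_eq hδ0 hδ1 hl0 hl1 hφ hlin (heq.trans_lt hB) (fun ω hω => ?_)
      σ hσ p₁
    have hmem : ω ∈ ({A, B, C} : Finset Ω) := huniv ▸ Finset.mem_univ ω
    simp only [Finset.mem_insert, Finset.mem_singleton] at hmem
    rcases hmem with rfl | rfl | rfl
    exacts [absurd hω (not_lt.2 hA), heq.symm, rfl]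
  · have T : IsTwoNegative r m A B C := ⟨huniv, hAB, hAC, hBC, hA, hB, hlt, hm⟩
    have hμ := neg_mul_sum_le_dotProduct T.C_le m.2.1
    rw [m.2.2, mul_one] at hμ
    obtain ⟨v, s, F, h⟩ := exists_isReducedFamily hδ0 hδ1 hl0 hl1 (neg_pos.2 T.neg_C) hμ
    exact T.isOptimal h hδ0 hl0 hl1 hδ1 hφ hlin σ hσ p₁

/-- The hypothesis on `m`, reduced to a linear inequality in a suitable labelling of the states. -/
theorem exists_labelling_of_card_eq_two (hΩ : Fintype.card Ω = 3) (h2 : (negStates r).card = 2)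
    (hm : m ∈ investRegion r ∨ InTriangle r m) :
    ∃ A B C, A ≠ B ∧ A ≠ C ∧ B ≠ C ∧ 0 ≤ r A ∧ r B < 0 ∧ r C ≤ r B ∧
      0 ≤ m.1 A * r A + m.1 B * r B := by
  rcases hm with hm | hm
  · obtain ⟨B, C, hBC, hneg, hCB⟩ : ∃ B C, B ≠ C ∧ negStates r = {B, C} ∧ r C ≤ r B := by
      obtain ⟨B, C, hBC, hneg⟩ := Finset.card_eq_two.1 h2
      rcases le_total (r C) (r B) with h | h
      · exact ⟨B, C, hBC, hneg, h⟩
      · exact ⟨C, B, hBC.symm, hneg.trans (Finset.pair_comm B C), h⟩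
    obtain ⟨A, hAB, hAC⟩ := exists_third hΩ B C
    have hB : r B < 0 := mem_negStates.1 (by simp [hneg])
    have hC : r C < 0 := mem_negStates.1 (by simp [hneg])
    have hA : 0 ≤ r A := not_lt.1 fun h => by
      have := mem_negStates.2 h
      simp [hneg, hAB, hAC] at this
    refine ⟨A, B, C, hAB, hAC, hBC, hA, hB, hCB, ?_⟩
    have h1 : 0 ≤ ∑ ω, m.1 ω * r ω := hm
    rw [univ_eq_of_card hΩ hAB hAC hBC, Finset.sum_insert (by simp [hAB, hAC]),
      Finset.sum_pair hBC] at h1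
    have := mul_nonpos_of_nonneg_of_nonpos (m.2.1 C) hC.le
    linarith
  · obtain ⟨A, B, C, Bplus, Cplus, hA, hneg, hBC, hCB, hB, hB', -, hC', hm⟩ := hm
    have hBn : r B < 0 := mem_negStates.1 (by simp [hneg])
    have hCn : r C < 0 := mem_negStates.1 (by simp [hneg])
    have hAB : A ≠ B := fun e => (hA.trans_lt (e ▸ hBn)).false
    have hAC : A ≠ C := fun e => (hA.trans_lt (e ▸ hCn)).false
    exact ⟨A, B, C, hAB, hAC, hBC, hA, hBn, hCB,
      center_nonneg_of_mem_triangle hA hAB hAC hBC hΩ hB hB' hC' hm⟩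

end ThreeStates

end Persuasion

open Persuasion
theorem theorem5 {Ω : Type*} [Fintype Ω] [DecidableEq Ω] (hΩ : Fintype.card Ω = 3)
    (r : Ω → ℝ) (δ : ℝ) (hδ0 : 0 ≤ δ) (hδ1 : δ < 1)
    (M : Matrix Ω Ω ℝ) (hM : M ∈ Matrix.rowStochastic ℝ Ω) (hirr : M.IsIrreducible)
    (m : Belief Ω) (hm : drift M hM m = m) (hhom : IsHomothety (drift M hM) m)
    (hcase : (negStates r).card = 1 ∨
      ((negStates r).card = 2 ∧ (m ∈ investRegion r ∨ InTriangle r m))) :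
    (∃ s : StationaryStrategy Ω, s.IsGreedy r) ∧
    ∀ s : StationaryStrategy Ω, s.IsGreedy r → ∀ p₁ : Belief Ω,
      (s.toStrategy (measurable_drift M hM) p₁).IsOptimal r δ := by
  obtain ⟨lam, hl0, hl1, hlin⟩ := hhom.exists_linDrift
  rcases hcase with h1 | ⟨h2, hm'⟩
  · obtain ⟨C, hneg⟩ := Finset.card_eq_one.1 h1
    have hC : r C < 0 := mem_negStates.1 (by simp [hneg])
    have hnonneg : ∀ ω, ω ≠ C → 0 ≤ r ω := fun ω hω => not_lt.1 fun h => by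
      have := mem_negStates.2 h
      simp [hneg, hω] at this
    obtain ⟨A, hAC, -⟩ := exists_third hΩ C C
    obtain ⟨B, hBA, hBC⟩ := exists_third hΩ A C
    refine ⟨exists_isGreedy (univ_eq_of_card hΩ hBA.symm hAC hBC) hBA.symm hAC hBC (hnonneg A hAC)
      hC (hC.le.trans (hnonneg B hBC)), fun s hs p₁ => ?_⟩
    refine isOptimal_of_forall_neg_eq hδ0 hδ1 hl0 hl1 _ hlin hC (fun ω hω => ?_) s hs p₁
    by_contra hne
    exact absurd hω (not_lt.2 (hnonneg ω fun e => hne (by rw [e])))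
  · obtain ⟨A, B, C, hAB, hAC, hBC, hA, hB, hCB, hside⟩ :=
      exists_labelling_of_card_eq_two hΩ h2 hm'
    exact ⟨exists_isGreedy (univ_eq_of_card hΩ hAB hAC hBC) hAB hAC hBC hA (hCB.trans_lt hB) hCB,
      fun s hs p₁ => isOptimal_of_two_neg hΩ hδ0 hδ1 hl0 hl1 _ hlin hAB hAC hBC hA hB hCB hside
        s hs p₁⟩
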